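/- For complex matrices, let $r(\cdot)$ denote rank, $\mathscr R(\cdot)$ the range (column space), $(\cdot)^*$ the conjugate transpose, and, for a Hermitian matrix, let $i_+(\cdot)$ and $i_-(\cdot)$ denote the numbers of positive and of negative eigenvalues, counted with multiplicity. Write $X\succ 0$ ($X\succcurlyeq 0$) if $X$ is Hermitian positive definite (positive semidefinite), and $X\prec 0$ ($X\preccurlyeq 0$) if $-X\succ0$ ($-X\succcurlyeq 0$). **Theorem.** Let $A\in\mathbb C^{m\times m}$ be Hermitian, $B_1\in\mathbb C^{m\times n_1}$, $B_2\in\mathbb C^{m\times n_2}$, and $B=[\,B_1,\,B_2\,]$. Assume that the equation $$[\,B_1,\,B_2\,]\begin{bmatrix}X_1&X_2\\X_2^*&X_3\end{bmatrix}\begin{bmatrix}B_1^*\\B_2^*\end{bmatrix}=A\qquad(\star)$$ has a Hermitian solution, i.e. one with $X_1\in\mathbb C^{n_1\times n_1}$ and $X_3\in\mathbb C^{n_2\times n_2}$ Hermitian and $X_2\in\mathbb C^{n_1\times n_2}$. Let $\mathcal S_1$ and $\mathcal S_3$ be the sets of all blocks $X_1$, respectively $X_3$, of Hermitian solutions of $(\star)$,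 and put $$M_1=\begin{bmatrix}A&B_1\\B_1^*&0\end{bmatrix},\qquad M_2=\begin{bmatrix}A&B_2\\B_2^*&0\end{bmatrix}.$$ Then (each formula with $\pm$ holding for both signs) $$\max_{X_1\in\mathcal S_1}r(X_1)=\min\{n_1,\ r(M_2)-2r(B)+2n_1\},\qquad \min_{X_1\in\mathcal S_1}r(X_1)=r(M_2)-2r(B_2),$$ $$\max_{X_1\in\mathcal S_1}i_\pm(X_1)=i_\pm(M_2)-r(B)+n_1,\qquad \min_{X_1\in\mathcal S_1}i_\pm(X_1)=i_\pm(M_2)-r(B_2),$$ $$\max_{X_3\in\mathcal S_3}r(X_3)=\min\{n_2,\ r(M_1)-2r(B)+2n_2\},\qquad \min_{X_3\in\mathcal S_3}r(X_3)=r(M_1)-2r(B_1),$$ $$\max_{X_3\in\mathcal S_3}i_\pm(X_3)=i_\pm(M_1)-r(B)+n_2,\qquad \min_{X_3\in\mathcal S_3}i_\pm(X_3)=i_\pm(M_1)-r(B_1).$$ Moreover: 1. $(\star)$ has a Hermitian solution in which $X_1$ is nonsingular if and only if $r(M_2)\ge 2r(B)-n_1$. 2. $X_1$ is nonsingular in every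 Hermitian solution of $(\star)$ if and only if $r(M_2)=2r(B_2)+n_1$. 3. $(\star)$ has a Hermitian solution with $X_1=0$ if and only if $r(M_2)=2r(B_2)$. 4. $X_1=0$ in every Hermitian solution of $(\star)$ if and only if $r(M_2)=2r(B)-2n_1$. 5. $(\star)$ has a Hermitian solution with $X_1\succ0$ (respectively $X_1\prec0$) if and only if $i_+(M_2)=r(B)$ (respectively $i_-(M_2)=r(B)$). 6. $X_1\succ0$ (respectively $X_1\prec0$) in every Hermitian solution of $(\star)$ if and only if $i_+(M_2)=n_1+r(B_2)$ (respectively $i_-(M_2)=n_1+r(B_2)$). 7. $(\star)$ has a Hermitian solution with $X_1\succcurlyeq0$ (respectively $X_1\preccurlyeq0$) if and only if $i_-(M_2)=r(B_2)$ (respectively $i_+(M_2)=r(B_2)$). 8. $X_1\succcurlyeq0$ (respectively $X_1\preccurlyeq0$) in every Hermitian solution of $(\star)$ if and only if $i_-(M_2)=r(B)-n_1$ (respectively $i_+(M_2)=r(B)-n_1$). 9. The following are equivalent: $i_+(X_1)$ is the same for all Hermitian solutions of $(\star)$; $i_-(X_1)$ is the same for all Hermitian solutions of $(\star)$; $\mathscr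 R(B_1)\cap\mathscr R(B_2)=\{0\}$ and $r(B_1)=n_1$. -/

import Mathlib

open Matrix
open scoped ComplexOrder

/-- The positive index of inertia `i₊(A)`: the number of positive eigenvalues of `A`, counted with
(algebraic) multiplicity. It is used for Hermitian matrices only, whose eigenvalues are all real;
`0 < z` for complex `z` means that `z` is a positive real number. -/
noncomputable def posInertia {ι : Type*} [Fintype ι] [DecidableEq ι] (A : Matrix ι ι ℂ) : ℕ :=
  open Classical in (A.charpoly.roots.filter (fun z : ℂ => 0 < z)).card

/-- The negative index of inertia `i₋(A)`: the number of negative eigenvalues of `A`, counted with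
(algebraic) multiplicity. -/
noncomputable def negInertia {ι : Type*} [Fintype ι] [DecidableEq ι] (A : Matrix ι ι ℂ) : ℕ :=
  open Classical in (A.charpoly.roots.filter (fun z : ℂ => z < 0)).card

/-- The set of Hermitian solutions `X` (partitioned as `[X₁, X₂; X₂*, X₃]`) of
`[B₁, B₂] X [B₁, B₂]* = A`. -/
def hermSolutions {m n₁ n₂ : ℕ} (A : Matrix (Fin m) (Fin m) ℂ)
    (B₁ : Matrix (Fin m) (Fin n₁) ℂ) (B₂ : Matrix (Fin m) (Fin n₂) ℂ) :
    Set (Matrix (Fin n₁ ⊕ Fin n₂) (Fin n₁ ⊕ Fin n₂) ℂ) :=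
  {X | X.IsHermitian ∧ fromCols B₁ B₂ * X * (fromCols B₁ B₂)ᴴ = A}

/-- The set `𝒮₁` of the blocks `X₁` of the Hermitian solutions. -/
def solBlocks₁ {m n₁ n₂ : ℕ} (A : Matrix (Fin m) (Fin m) ℂ)
    (B₁ : Matrix (Fin m) (Fin n₁) ℂ) (B₂ : Matrix (Fin m) (Fin n₂) ℂ) :
    Set (Matrix (Fin n₁) (Fin n₁) ℂ) :=
  {X₁ | ∃ X ∈ hermSolutions A B₁ B₂, X.toBlocks₁₁ = X₁}

/-- The set `𝒮₃` of the blocks `X₃` of the Hermitian solutions. -/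
def solBlocks₃ {m n₁ n₂ : ℕ} (A : Matrix (Fin m) (Fin m) ℂ)
    (B₁ : Matrix (Fin m) (Fin n₁) ℂ) (B₂ : Matrix (Fin m) (Fin n₂) ℂ) :
    Set (Matrix (Fin n₂) (Fin n₂) ℂ) :=
  {X₃ | ∃ X ∈ hermSolutions A B₁ B₂, X.toBlocks₂₂ = X₃}

/-- The bordered Hermitian matrix `[A, B; B*, 0]`. -/
def bordered {m k : ℕ} (A : Matrix (Fin m) (Fin m) ℂ) (B : Matrix (Fin m) (Fin k) ℂ) :
    Matrix (Fin m ⊕ Fin k) (Fin m ⊕ Fin k) ℂ :=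
  fromBlocks A B Bᴴ 0

/-! ### Inertia of Hermitian matrices under compression; generalized inverses. -/

section Inertia

/-! Choose a generalized inverse `B'` of `B₂` and put `Q = 1 - B₂ * B'`, so that `Q` annihilates
exactly the range of `B₂`. Multiplying the equation by `Q` on the left and `Qᴴ` on the right
eliminates all blocks but `X₁`, and nothing is lost: the admissible `X₁` are precisely the Hermitian
solutions of `C X₁ Cᴴ = Q A Qᴴ` with `C = Q B₁` (`mem_solBlocks₁_iff`).

It remains to see how rank and inertia vary over Hermitian matrices with a prescribed compression `H
= C X₁ Cᴴ`. Compression cannot raise either index (`posInertia_conj_le`) and lowers it by at most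
`n₁ - r(C)` (`posInertia_add_rank_le`); the `exists_extension_*` lemmas show that these bounds, and
the resulting bound on the rank, are attained.

The data are then translated back by `i±(M₂) = i±(Q A Qᴴ) + r(B₂)` (`inertia_bordered`) and `r(B) =
r(C) + r(B₂)` (`rank_fromCols_eq`). Each numbered item says that some extremal value is `0`, is
`n₁`, or that a maximum equals the corresponding minimum. The statements on `X₃` follow by
exchanging the two column blocks. -/

theorem star_dotProduct_conj_mulVec {ι κ : Type*} [Fintype ι] [Fintype κ] (A : Matrix ι ι ℂ)
    (G : Matrix ι κ ℂ) (x : κ → ℂ) :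
    star x ⬝ᵥ (Gᴴ * A * G) *ᵥ x = star (G *ᵥ x) ⬝ᵥ A *ᵥ (G *ᵥ x) := by
  rw [star_mulVec, ← dotProduct_mulVec, mulVec_mulVec, mulVec_mulVec, Matrix.mul_assoc]

theorem rank_add_finrank_ker {ι κ : Type*} [Fintype ι] (A : Matrix κ ι ℂ) :
    A.rank + Module.finrank ℂ (LinearMap.ker A.mulVecLin) = Fintype.card ι := by
  rw [Matrix.rank, LinearMap.finrank_range_add_finrank_ker, Module.finrank_fintype_fun_eq_card]

variable {ι κ : Type*} [Fintype ι] [DecidableEq ι] [Fintype κ] [DecidableEq κ]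

theorem posInertia_eq_card {A : Matrix ι ι ℂ} (hA : A.IsHermitian) :
    posInertia A = Fintype.card {i // 0 < hA.eigenvalues i} := by
  classical
  rw [posInertia, hA.roots_charpoly_eq_eigenvalues, Multiset.filter_map, Multiset.card_map,
    Fintype.card_subtype, Finset.card_def, Finset.filter_val]
  congr 1
  apply Multiset.filter_congr
  intro i _
  simp

theorem negInertia_eq_card {A : Matrix ι ι ℂ} (hA : A.IsHermitian) :
    negInertia A = Fintype.card {i // hA.eigenvalues i < 0} := by
  classical
  rw [negInertia, hA.roots_charpoly_eq_eigenvalues, Multiset.filter_map, Multiset.card_map,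
    Fintype.card_subtype, Finset.card_def, Finset.filter_val]
  congr 1
  apply Multiset.filter_congr
  intro i _
  simp [← Complex.real_lt_real]

theorem Matrix.IsHermitian.charpoly_neg_eq {A : Matrix ι ι ℂ} (hA : A.IsHermitian) :
    (-A).charpoly = ∏ i, (Polynomial.X - Polynomial.C (-(hA.eigenvalues i : ℂ))) := by
  have h := hA.spectral_theorem
  have h2 : -A = Unitary.conjStarAlgAut ℂ _ hA.eigenvectorUnitary
      (diagonal fun i => -(hA.eigenvalues i : ℂ)) := by
    conv_lhs => rw [h]
    rw [← map_neg, diagonal_neg]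
    rfl
  rw [h2, Unitary.conjStarAlgAut_apply, charpoly_mul_comm, ← mul_assoc]
  simp [charpoly_diagonal]

theorem posInertia_neg {A : Matrix ι ι ℂ} (hA : A.IsHermitian) :
    posInertia (-A) = negInertia A := by
  classical
  rw [negInertia_eq_card hA, posInertia, hA.charpoly_neg_eq,
    Polynomial.roots_prod _ _ (Finset.prod_ne_zero_iff.mpr
      fun i _ => Polynomial.X_sub_C_ne_zero _)]
  simp only [Polynomial.roots_X_sub_C, Multiset.bind_singleton]
  rw [Multiset.filter_map, Multiset.card_map,
    Fintype.card_subtype, Finset.card_def, Finset.filter_val]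
  congr 1
  apply Multiset.filter_congr
  intro i _
  simp [← Complex.real_lt_real]

theorem negInertia_neg {A : Matrix ι ι ℂ} (hA : A.IsHermitian) :
    negInertia (-A) = posInertia A := by
  rw [← posInertia_neg hA.neg, neg_neg]

theorem rank_eq_posInertia_add_negInertia {A : Matrix ι ι ℂ} (hA : A.IsHermitian) :
    A.rank = posInertia A + negInertia A := by
  classical
  rw [hA.rank_eq_card_non_zero_eigs, posInertia_eq_card hA, negInertia_eq_card hA,
    Fintype.card_subtype, Fintype.card_subtype, Fintype.card_subtype,
    ← Finset.card_union_of_disjoint]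
  · congr 1
    ext i
    simp only [Finset.mem_filter, Finset.mem_union, Finset.mem_univ, true_and]
    exact ne_iff_lt_or_gt.trans or_comm
  · rw [Finset.disjoint_filter]
    intro i _ h
    exact not_lt.2 h.le

theorem posInertia_eq_card_iff {A : Matrix ι ι ℂ} (hA : A.IsHermitian) :
    posInertia A = Fintype.card ι ↔ A.PosDef := by
  classical
  rw [hA.posDef_iff_eigenvalues_pos, posInertia_eq_card hA, Fintype.card_subtype,
    Finset.card_eq_iff_eq_univ, Finset.filter_eq_self]
  simp

theorem negInertia_eq_zero_iff {A : Matrix ι ι ℂ} (hA : A.IsHermitian) :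
    negInertia A = 0 ↔ A.PosSemidef := by
  classical
  rw [hA.posSemidef_iff_eigenvalues_nonneg, negInertia_eq_card hA, Fintype.card_eq_zero_iff,
    isEmpty_subtype]
  simp [Pi.le_def]

theorem negInertia_eq_card_iff {A : Matrix ι ι ℂ} (hA : A.IsHermitian) :
    negInertia A = Fintype.card ι ↔ (-A).PosDef := by
  rw [← posInertia_neg hA, posInertia_eq_card_iff hA.neg]

theorem posInertia_eq_zero_iff {A : Matrix ι ι ℂ} (hA : A.IsHermitian) :
    posInertia A = 0 ↔ (-A).PosSemidef := by
  rw [← negInertia_neg hA, negInertia_eq_zero_iff hA.neg]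

theorem Matrix.PosSemidef.posInertia_eq_rank {A : Matrix ι ι ℂ} (hA : A.PosSemidef) :
    posInertia A = A.rank := by
  rw [rank_eq_posInertia_add_negInertia hA.isHermitian,
    (negInertia_eq_zero_iff hA.isHermitian).2 hA, add_zero]

theorem posInertia_fromBlocks_diagonal (A : Matrix ι ι ℂ) (D : Matrix κ κ ℂ) :
    posInertia (fromBlocks A 0 0 D) = posInertia A + posInertia D := by
  classical
  rw [posInertia, posInertia, posInertia, charpoly_fromBlocks_zero₁₂, Polynomial.roots_mul
    (mul_ne_zero (charpoly_monic A).ne_zero (charpoly_monic D).ne_zero), Multiset.filter_add,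
    Multiset.card_add]

/-- The span of the eigenvectors whose eigenvalues satisfy `p`. -/
theorem Matrix.IsHermitian.exists_submodule_eigenvalues {A : Matrix ι ι ℂ} (hA : A.IsHermitian)
    (p : ℝ → Prop) [DecidablePred p] :
    ∃ W : Submodule ℂ (ι → ℂ), Module.finrank ℂ W = Nat.card {i // p (hA.eigenvalues i)} ∧
      ∀ x ∈ W, ∃ y : {i // p (hA.eigenvalues i)} → ℂ, (x ≠ 0 → y ≠ 0) ∧
        (star x ⬝ᵥ A *ᵥ x).re = ∑ i : {i // p (hA.eigenvalues i)},
          hA.eigenvalues i.1 * Complex.normSq (y i) := by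
  classical
  set U : Matrix ι ι ℂ := (hA.eigenvectorUnitary : Matrix ι ι ℂ) with hU
  have hUU : Uᴴ * U = 1 := Unitary.coe_star_mul_self hA.eigenvectorUnitary
  have hA' : Uᴴ * A * U = diagonal (fun i => (hA.eigenvalues i : ℂ)) := by
    have h := hA.spectral_theorem
    rw [Unitary.conjStarAlgAut_apply] at h
    change A = U * _ * Uᴴ at h
    calc Uᴴ * A * U = (Uᴴ * U) * diagonal (fun i => (hA.eigenvalues i : ℂ)) * (Uᴴ * U) := by
          conv_lhs => rw [h]
          simp only [Matrix.mul_assoc]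
          rfl
      _ = _ := by rw [hUU, Matrix.one_mul, Matrix.mul_one]
  -- The selected orthonormal eigenvectors as columns: an isometry that compresses `A` to the
  -- diagonal of the selected eigenvalues.
  set K : Matrix ι {i // p (hA.eigenvalues i)} ℂ := U.submatrix id Subtype.val with hK
  have hKK : Kᴴ * K = 1 := by
    have : Kᴴ * K = (Uᴴ * U).submatrix Subtype.val Subtype.val := by
      ext i j; simp [K, mul_apply]
    rw [this, hUU]
    exact submatrix_one _ Subtype.val_injective
  have hKA : Kᴴ * A * K = diagonal (fun i => (hA.eigenvalues i.1 : ℂ)) := by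
    have : Kᴴ * A * K = (Uᴴ * A * U).submatrix Subtype.val Subtype.val := by
      ext i j; simp [K, mul_apply]
    rw [this, hA']
    exact submatrix_diagonal _ _ Subtype.val_injective
  refine ⟨LinearMap.range K.mulVecLin, ?_, ?_⟩
  · rw [LinearMap.finrank_range_of_inj, Module.finrank_fintype_fun_eq_card,
      Nat.card_eq_fintype_card]
    intro x y hxy
    have := congrArg (fun z => Kᴴ *ᵥ z) hxy
    simpa [mulVec_mulVec, hKK] using this
  · rintro x ⟨y, rfl⟩
    refine ⟨y, fun hx hy => hx (by simp [hy]), ?_⟩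
    have : star (K.mulVecLin y) ⬝ᵥ A *ᵥ (K.mulVecLin y) = star y ⬝ᵥ (Kᴴ * A * K) *ᵥ y := by
      rw [mulVecLin_apply, star_mulVec, ← dotProduct_mulVec, mulVec_mulVec, mulVec_mulVec,
        Matrix.mul_assoc]
    rw [this, hKA, dotProduct, Complex.re_sum]
    refine Finset.sum_congr rfl fun i _ => ?_
    rw [mulVec_diagonal, Pi.star_apply, Complex.normSq_apply]
    simp
    ring

theorem Matrix.IsHermitian.exists_posDef_submodule {A : Matrix ι ι ℂ} (hA : A.IsHermitian) :
    ∃ W : Submodule ℂ (ι → ℂ), Module.finrank ℂ W = posInertia A ∧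
      ∀ x ∈ W, x ≠ 0 → 0 < (star x ⬝ᵥ A *ᵥ x).re := by
  obtain ⟨W, hW, h⟩ := hA.exists_submodule_eigenvalues (fun t => 0 < t)
  refine ⟨W, by rw [hW, posInertia_eq_card hA, Nat.card_eq_fintype_card], fun x hx hx0 => ?_⟩
  obtain ⟨y, hy, he⟩ := h x hx
  rw [he]
  obtain ⟨i, hi⟩ := Function.ne_iff.1 (hy hx0)
  exact Finset.sum_pos' (fun j _ => mul_nonneg j.2.le (Complex.normSq_nonneg _))
    ⟨i, Finset.mem_univ _, mul_pos i.2 (Complex.normSq_pos.2 hi)⟩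

/-- A subspace on which the form is positive definite can meet this one only in `0`. Comparing
dimensions then bounds the first by `posInertia A`, which is how inertia inequalities are obtained
below. -/
theorem Matrix.IsHermitian.exists_nonpos_submodule {A : Matrix ι ι ℂ} (hA : A.IsHermitian) :
    ∃ W : Submodule ℂ (ι → ℂ), Module.finrank ℂ W + posInertia A = Fintype.card ι ∧
      ∀ x ∈ W, (star x ⬝ᵥ A *ᵥ x).re ≤ 0 := by
  obtain ⟨W, hW, h⟩ := hA.exists_submodule_eigenvalues (fun t => ¬ 0 < t)
  refine ⟨W, ?_, fun x hx => ?_⟩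
  · have := Fintype.card_subtype_compl (fun i => 0 < hA.eigenvalues i)
    have h2 := Fintype.card_subtype_le (fun i => 0 < hA.eigenvalues i)
    rw [hW, posInertia_eq_card hA, Nat.card_eq_fintype_card]
    omega
  · obtain ⟨y, -, he⟩ := h x hx
    rw [he]
    exact Finset.sum_nonpos fun i _ =>
      mul_nonpos_of_nonpos_of_nonneg (not_lt.1 i.2) (Complex.normSq_nonneg _)

/-- Compressing a Hermitian matrix does not increase its positive index of inertia. -/
theorem posInertia_conj_le {A : Matrix ι ι ℂ} (hA : A.IsHermitian) (G : Matrix ι κ ℂ) :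
    posInertia (Gᴴ * A * G) ≤ posInertia A := by
  obtain ⟨W, hW, hpos⟩ := (isHermitian_conjTranspose_mul_mul G hA).exists_posDef_submodule
  obtain ⟨N, hN, hneg⟩ := hA.exists_nonpos_submodule
  -- A vector killed by `G` has value `0` under the compressed form, so `G` preserves the dimension
  -- of the positive subspace `W`.
  have hinj : Function.Injective (G.mulVecLin.domRestrict W) := by
    rw [← LinearMap.ker_eq_bot, LinearMap.ker_eq_bot']
    rintro ⟨x, hx⟩ h0
    by_contra hne
    have h0' : G *ᵥ x = 0 := h0
    have := hpos x hx (fun h => hne (by simp [h]))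
    rw [star_dotProduct_conj_mulVec, h0'] at this
    simp at this
  have hfr := LinearMap.finrank_range_of_inj hinj
  have hdisj : LinearMap.range (G.mulVecLin.domRestrict W) ⊓ N = ⊥ := by
    rw [eq_bot_iff]
    rintro _ ⟨⟨⟨x, hx⟩, rfl⟩, hxN⟩
    have h1 := hneg _ hxN
    by_contra hne
    have h2 := hpos x hx (fun h => hne (by simp [h]))
    rw [star_dotProduct_conj_mulVec] at h2
    exact absurd h2 (not_lt.2 h1)
  have h1 := Submodule.finrank_sup_add_finrank_inf_eq
    (LinearMap.range (G.mulVecLin.domRestrict W)) N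
  rw [hdisj, finrank_bot] at h1
  have h2 := Submodule.finrank_le (LinearMap.range (G.mulVecLin.domRestrict W) ⊔ N)
  rw [Module.finrank_fintype_fun_eq_card] at h2
  omega

theorem negInertia_conj_le {A : Matrix ι ι ℂ} (hA : A.IsHermitian) (G : Matrix ι κ ℂ) :
    negInertia (Gᴴ * A * G) ≤ negInertia A := by
  have h := posInertia_conj_le hA.neg G
  rwa [Matrix.mul_neg, Matrix.neg_mul, posInertia_neg (isHermitian_conjTranspose_mul_mul G hA),
    posInertia_neg hA] at h

/-- The forms of `A` and `Pᴴ * A * P` agree on the kernel of `1 - P`, a subspace of codimension `(1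
- P).rank`. Inside it, a positive subspace for the first and a nonpositive one for the second meet
trivially. -/
theorem posInertia_le_conj_add {A : Matrix ι ι ℂ} (hA : A.IsHermitian) (P : Matrix ι ι ℂ) :
    posInertia A ≤ posInertia (Pᴴ * A * P) + (1 - P).rank := by
  obtain ⟨W, hW, hpos⟩ := hA.exists_posDef_submodule
  obtain ⟨N, hN, hneg⟩ := (isHermitian_conjTranspose_mul_mul P hA).exists_nonpos_submodule
  have hK : (1 - P).rank + Module.finrank ℂ (LinearMap.ker (1 - P).mulVecLin)
      = Fintype.card ι := by
    rw [Matrix.rank, LinearMap.finrank_range_add_finrank_ker, Module.finrank_fintype_fun_eq_card]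
  set K := LinearMap.ker (1 - P).mulVecLin
  have hdisj : W ⊓ (N ⊓ K) = ⊥ := by
    rw [eq_bot_iff]
    rintro x ⟨hx, hxN, hxK⟩
    have hPx : P *ᵥ x = x := by
      have : (1 - P) *ᵥ x = 0 := hxK
      rw [sub_mulVec, one_mulVec, sub_eq_zero] at this
      exact this.symm
    have h1 := hneg _ hxN
    by_contra hne
    have h2 := hpos x hx (fun h => hne (by simp [h]))
    rw [star_dotProduct_conj_mulVec, hPx] at h1
    exact absurd h2 (not_lt.2 h1)
  have h1 := Submodule.finrank_sup_add_finrank_inf_eq W (N ⊓ K)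
  have h2 := Submodule.finrank_sup_add_finrank_inf_eq N K
  rw [hdisj, finrank_bot] at h1
  have h3 := Submodule.finrank_le (W ⊔ N ⊓ K)
  have h4 := Submodule.finrank_le (N ⊔ K)
  rw [Module.finrank_fintype_fun_eq_card] at h3 h4
  omega

theorem isUnit_iff_rank_eq_card (A : Matrix ι ι ℂ) : IsUnit A ↔ A.rank = Fintype.card ι := by
  refine ⟨rank_of_isUnit A, fun h => ?_⟩
  rw [← mulVec_surjective_iff_isUnit]
  have : LinearMap.range A.mulVecLin = ⊤ :=
    Submodule.eq_top_of_finrank_eq (by rw [Module.finrank_fintype_fun_eq_card]; exact h)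
  exact LinearMap.range_eq_top.1 this

theorem matrix_rank_eq_zero_iff {κ : Type*} (A : Matrix κ ι ℂ) : A.rank = 0 ↔ A = 0 := by
  refine ⟨fun h => ?_, fun h => by rw [h, rank_zero]⟩
  rw [Matrix.rank, Submodule.finrank_eq_zero, LinearMap.range_eq_bot] at h
  exact (LinearEquiv.map_eq_zero_iff Matrix.toLin').1 h

theorem exists_generalized_inverse (G : Matrix κ ι ℂ) :
    ∃ G' : Matrix ι κ ℂ, G * G' * G = G ∧ G' * G * G' = G' := by
  obtain ⟨s, hs⟩ := G.mulVecLin.rangeRestrict.exists_rightInverse_of_surjective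
    (LinearMap.range_rangeRestrict _)
  obtain ⟨p, hp⟩ := (LinearMap.range G.mulVecLin).subtype.exists_leftInverse_of_injective
    (Submodule.ker_subtype _)
  have key : ∀ x, G *ᵥ (s (p (G *ᵥ x))) = G *ᵥ x := by
    intro x
    have h1 : p (G *ᵥ x) = G.mulVecLin.rangeRestrict x :=
      LinearMap.congr_fun hp (G.mulVecLin.rangeRestrict x)
    have h2 := LinearMap.congr_fun hs (G.mulVecLin.rangeRestrict x)
    rw [h1]
    exact congrArg Subtype.val h2
  have hG : G * LinearMap.toMatrix' (s ∘ₗ p) * G = G := by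
    apply Matrix.toLin'.injective
    refine LinearMap.ext fun x => ?_
    simpa [← mulVec_mulVec, LinearMap.toMatrix'_mulVec] using key _
  set g := LinearMap.toMatrix' (s ∘ₗ p)
  -- `g` satisfies only the first identity; `g * G * g` satisfies both.
  refine ⟨g * G * g, ?_, ?_⟩
  · calc G * (g * G * g) * G = (G * g * G) * g * G := by simp only [Matrix.mul_assoc]
      _ = G := by rw [hG, hG]
  · calc g * G * g * G * (g * G * g) = g * ((G * g * G) * g * G) * g := by
          simp only [Matrix.mul_assoc]
      _ = _ := by rw [hG, hG]

end Inertia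

/-! ### Hermitian matrices with a prescribed compression `Gᴴ * X * G`. -/

section Extension

variable {ι κ : Type*} [Fintype ι] [DecidableEq ι] [Fintype κ] [DecidableEq κ]

theorem rank_mul_generalized_inverse {ι κ : Type*} [Fintype ι] [Fintype κ]
    {G : Matrix ι κ ℂ} {G' : Matrix κ ι ℂ}
    (h : G * G' * G = G) : (G * G').rank = G.rank :=
  le_antisymm (rank_mul_le_left _ _) (by
    conv_lhs => rw [← h]
    exact rank_mul_le_left _ _)

theorem range_mul_generalized_inverse {κ : Type*} [Fintype κ] {G : Matrix ι κ ℂ} {G' : Matrix κ ι ℂ}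
    (h : G * G' * G = G) :
    LinearMap.range (G * G').mulVecLin = LinearMap.ker (1 - G * G').mulVecLin := by
  ext x
  simp only [LinearMap.mem_range, LinearMap.mem_ker, mulVecLin_apply, sub_mulVec, one_mulVec,
    sub_eq_zero]
  refine ⟨?_, fun hx => ⟨x, hx.symm⟩⟩
  rintro ⟨y, rfl⟩
  rw [mulVec_mulVec, ← Matrix.mul_assoc, h]

theorem rank_one_sub_mul_generalized_inverse {κ : Type*} [Fintype κ]
    {G : Matrix ι κ ℂ} {G' : Matrix κ ι ℂ}
    (h : G * G' * G = G) : G.rank + (1 - G * G').rank = Fintype.card ι := by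
  rw [← rank_add_finrank_ker (1 - G * G'), ← range_mul_generalized_inverse h, add_comm,
    ← rank_mul_generalized_inverse h, Matrix.rank, Matrix.rank]

/-- Truncate by `P = G * G'`: the loss is at most the rank of `1 - P`, which is the corank of `G`,
and compression by `P` factors through compression by `G`. -/
theorem posInertia_add_rank_le {X : Matrix ι ι ℂ} (hX : X.IsHermitian) (G : Matrix ι κ ℂ) :
    posInertia X + G.rank ≤ posInertia (Gᴴ * X * G) + Fintype.card ι := by
  obtain ⟨G', h, -⟩ := exists_generalized_inverse G
  have h1 := posInertia_le_conj_add hX (G * G')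
  have h2 := posInertia_conj_le (isHermitian_conjTranspose_mul_mul G hX) G'
  have h3 : G'ᴴ * (Gᴴ * X * G) * G' = (G * G')ᴴ * X * (G * G') := by
    simp only [conjTranspose_mul, Matrix.mul_assoc]
  have h4 := rank_one_sub_mul_generalized_inverse h
  rw [h3] at h2
  omega

theorem negInertia_add_rank_le {X : Matrix ι ι ℂ} (hX : X.IsHermitian) (G : Matrix ι κ ℂ) :
    negInertia X + G.rank ≤ negInertia (Gᴴ * X * G) + Fintype.card ι := by
  have h := posInertia_add_rank_le hX.neg G
  rwa [Matrix.mul_neg, Matrix.neg_mul, posInertia_neg (isHermitian_conjTranspose_mul_mul G hX),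
    posInertia_neg hX] at h

/-- Pull `Gᴴ * X * G` back along `G'`. Each of the two matrices is then a compression of the other,
so both indices agree simultaneously. -/
theorem exists_extension_min_inertia {X : Matrix ι ι ℂ} (hX : X.IsHermitian)
    (G : Matrix ι κ ℂ) :
    ∃ Y : Matrix ι ι ℂ, Y.IsHermitian ∧ Gᴴ * Y * G = Gᴴ * X * G ∧
      posInertia Y = posInertia (Gᴴ * X * G) ∧ negInertia Y = negInertia (Gᴴ * X * G) := by
  obtain ⟨G', h, -⟩ := exists_generalized_inverse G
  have hH := isHermitian_conjTranspose_mul_mul G hX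
  have hY := isHermitian_conjTranspose_mul_mul G' hH
  have hG : Gᴴ * (G'ᴴ * (Gᴴ * X * G) * G') * G = Gᴴ * X * G := by
    calc _ = (G * G' * G)ᴴ * X * (G * G' * G) := by
          simp only [conjTranspose_mul, Matrix.mul_assoc]
      _ = _ := by rw [h]
  refine ⟨G'ᴴ * (Gᴴ * X * G) * G', hY, hG,
    le_antisymm (posInertia_conj_le hH G') ?_, le_antisymm (negInertia_conj_le hH G') ?_⟩
  · conv_lhs => rw [← hG]
    exact posInertia_conj_le hY G
  · conv_lhs => rw [← hG]
    exact negInertia_conj_le hY G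

/-- To the pullback along `G'` add `Rᴴ * R` with `R = 1 - G * G'`. This term is invisible to `G` and
contributes the whole corank of `G` as positive directions. -/
theorem exists_extension_max_posInertia {X : Matrix ι ι ℂ} (hX : X.IsHermitian)
    (G : Matrix ι κ ℂ) :
    ∃ Y : Matrix ι ι ℂ, Y.IsHermitian ∧ Gᴴ * Y * G = Gᴴ * X * G ∧
      posInertia Y + G.rank = posInertia (Gᴴ * X * G) + Fintype.card ι := by
  obtain ⟨G', h, h'⟩ := exists_generalized_inverse G
  have hH := isHermitian_conjTranspose_mul_mul G hX
  set H := Gᴴ * X * G with hHdef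
  set R := 1 - G * G' with hR
  have hRG : R * G = 0 := by rw [hR, Matrix.sub_mul, Matrix.one_mul, h, sub_self]
  have hGR : G' * R = 0 := by
    rw [hR, Matrix.mul_sub, Matrix.mul_one, ← Matrix.mul_assoc, h', sub_self]
  have hRR : R * R = R := by
    conv_lhs => rw [hR]
    rw [Matrix.sub_mul, Matrix.one_mul, Matrix.mul_assoc, hGR, Matrix.mul_zero, sub_zero]
  have hGRt : Gᴴ * Rᴴ = 0 := by rw [← conjTranspose_mul, hRG, conjTranspose_zero]
  have hRGt : Rᴴ * G'ᴴ = 0 := by rw [← conjTranspose_mul, hGR, conjTranspose_zero]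
  have hRRt : Rᴴ * Rᴴ = Rᴴ := by rw [← conjTranspose_mul, hRR]
  have hGt : Gᴴ * G'ᴴ * Gᴴ = Gᴴ := by
    rw [← conjTranspose_mul, ← conjTranspose_mul, ← Matrix.mul_assoc, h]
  have hY : (G'ᴴ * H * G' + Rᴴ * R).IsHermitian :=
    (isHermitian_conjTranspose_mul_mul G' hH).add (isHermitian_conjTranspose_mul_self R)
  have hYG : (G'ᴴ * H * G' + Rᴴ * R) * G = G'ᴴ * H * (G' * G) := by
    rw [Matrix.add_mul, Matrix.mul_assoc Rᴴ, hRG, Matrix.mul_zero, add_zero, Matrix.mul_assoc]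
  have hYR : (G'ᴴ * H * G' + Rᴴ * R) * R = Rᴴ * R := by
    rw [Matrix.add_mul, Matrix.mul_assoc Rᴴ, hRR, Matrix.mul_assoc, hGR, Matrix.mul_zero, zero_add]
  have hG : Gᴴ * (G'ᴴ * H * G' + Rᴴ * R) * G = H := by
    calc _ = (Gᴴ * G'ᴴ * Gᴴ) * X * (G * G' * G) := by
          rw [Matrix.mul_assoc, hYG, hHdef]; simp only [Matrix.mul_assoc]
      _ = _ := by rw [h, hGt]
  set Y := G'ᴴ * H * G' + Rᴴ * R
  refine ⟨Y, hY, hG, le_antisymm ?_ ?_⟩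
  · have := posInertia_add_rank_le hY G
    rwa [hG] at this
  · have h1 := posInertia_conj_le hY (fromCols G R)
    have h2 : (fromCols G R)ᴴ * Y * fromCols G R = fromBlocks H 0 0 (Rᴴ * R) := by
      rw [conjTranspose_fromCols_eq_fromRows_conjTranspose, Matrix.mul_assoc, mul_fromCols,
        fromRows_mul_fromCols, ← Matrix.mul_assoc, hG, hYR, hYG]
      congr 1
      · rw [← Matrix.mul_assoc, hGRt, Matrix.zero_mul]
      · simp only [← Matrix.mul_assoc, hRGt, Matrix.zero_mul]
      · rw [← Matrix.mul_assoc, hRRt]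
    rw [h2, posInertia_fromBlocks_diagonal,
      (posSemidef_conjTranspose_mul_self R).posInertia_eq_rank, rank_conjTranspose_mul_self] at h1
    have h3 := rank_one_sub_mul_generalized_inverse h
    rw [← hR] at h3
    omega

theorem exists_extension_max_negInertia {X : Matrix ι ι ℂ} (hX : X.IsHermitian)
    (G : Matrix ι κ ℂ) :
    ∃ Y : Matrix ι ι ℂ, Y.IsHermitian ∧ Gᴴ * Y * G = Gᴴ * X * G ∧
      negInertia Y + G.rank = negInertia (Gᴴ * X * G) + Fintype.card ι := by
  obtain ⟨Y, hY, hG, h⟩ := exists_extension_max_posInertia hX.neg G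
  refine ⟨-Y, hY.neg, ?_, ?_⟩
  · rw [Matrix.mul_neg, Matrix.neg_mul, hG, Matrix.mul_neg, Matrix.neg_mul, neg_neg]
  · rwa [negInertia_neg hY, ← posInertia_neg (isHermitian_conjTranspose_mul_mul G hX),
      ← Matrix.neg_mul, ← Matrix.mul_neg]

/-- A matrix of the largest possible rank among those mapping `Z` into `W`, all of whose range is
already the image of `Z`. -/
theorem exists_matrix_map_eq_range (Z W : Submodule ℂ (ι → ℂ)) :
    ∃ T : Matrix ι ι ℂ, LinearMap.range T.mulVecLin ≤ W ∧
      Z.map T.mulVecLin = LinearMap.range T.mulVecLin ∧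
      T.rank = min (Module.finrank ℂ Z) (Module.finrank ℂ W) := by
  have key : ∀ V : Submodule ℂ (ι → ℂ), ∀ k ≤ Module.finrank ℂ V,
      ∃ f : (Fin k → ℂ) →ₗ[ℂ] (ι → ℂ), Function.Injective f ∧ LinearMap.range f ≤ V := by
    intro V k hk
    obtain ⟨f, hf⟩ := (finrank_le_iff_exists_linearMap (R := ℂ) (M := Fin k → ℂ)
      (M' := V)).1 (by simpa using hk)
    refine ⟨V.subtype ∘ₗ f, V.subtype_injective.comp hf, ?_⟩
    rintro _ ⟨x, rfl⟩
    exact (f x).2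
  obtain ⟨f, hf, hfZ⟩ := key Z _ (min_le_left _ (Module.finrank ℂ W))
  obtain ⟨g, hg, hgW⟩ := key W _ (min_le_right (Module.finrank ℂ Z) _)
  obtain ⟨q, hq⟩ := f.exists_leftInverse_of_injective (LinearMap.ker_eq_bot.2 hf)
  have hqf : ∀ y, q (f y) = y := fun y => LinearMap.congr_fun hq y
  have hT : (LinearMap.toMatrix' (g ∘ₗ q)).mulVecLin = g ∘ₗ q := by
    rw [← toLin'_apply', toLin'_toMatrix']
  have hr : LinearMap.range (g ∘ₗ q) = LinearMap.range g :=
    LinearMap.range_comp_of_range_eq_top _ (LinearMap.range_eq_top.2 fun y => ⟨f y, hqf y⟩)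
  refine ⟨LinearMap.toMatrix' (g ∘ₗ q), ?_, ?_, ?_⟩
  · rw [hT, hr]
    exact hgW
  · rw [hT]
    refine le_antisymm LinearMap.map_le_range ?_
    rw [hr]
    rintro _ ⟨y, rfl⟩
    exact ⟨f y, hfZ ⟨y, rfl⟩, by simp [hqf]⟩
  · rw [Matrix.rank, hT, hr, LinearMap.finrank_range_of_inj hg, Module.finrank_fin_fun]

/-- Split the space as range of `P` plus range of `R = 1 - P`. The block `N` on the first summand is
forced, and `Z` is its kernel there. A cross term `T` carries `Z` into the range of `R` with the
largest possible rank, and `Rᴴ * R` fills the remaining corner. The kernel of the sum lies in `Z ⊓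
ker T`, whose dimension is at most the excess of `dim Z` over `R.rank` (zero if there is none). -/
theorem exists_extension_max_rank {X : Matrix ι ι ℂ} (hX : X.IsHermitian)
    (G : Matrix ι κ ℂ) :
    ∃ Y : Matrix ι ι ℂ, Y.IsHermitian ∧ Gᴴ * Y * G = Gᴴ * X * G ∧
      min (Fintype.card ι + 2 * G.rank) ((Gᴴ * X * G).rank + 2 * Fintype.card ι) ≤
        Y.rank + 2 * G.rank := by
  obtain ⟨G', h, -⟩ := exists_generalized_inverse G
  set P := G * G' with hP
  set R := 1 - P with hR
  have hPG : P * G = G := h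
  have hPP : P * P = P := by rw [hP, ← Matrix.mul_assoc, h]
  have hRG : R * G = 0 := by rw [hR, Matrix.sub_mul, Matrix.one_mul, hPG, sub_self]
  have hPR : P * R = 0 := by rw [hR, Matrix.mul_sub, Matrix.mul_one, hPP, sub_self]
  have hRR : R * R = R := by
    nth_rw 1 [hR]
    rw [Matrix.sub_mul, Matrix.one_mul, hPR, sub_zero]
  have hPRt : Rᴴ * Pᴴ = 0 := by rw [← conjTranspose_mul, hPR, conjTranspose_zero]
  have hRRt : Rᴴ * Rᴴ = Rᴴ := by rw [← conjTranspose_mul, hRR]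
  set N := Pᴴ * X * P with hN
  have hNherm : N.IsHermitian := isHermitian_conjTranspose_mul_mul P hX
  have hNP : N * P = N := by rw [hN, Matrix.mul_assoc, hPP]
  have hNrank : N.rank = (Gᴴ * X * G).rank := by
    apply le_antisymm
    · have : N = G'ᴴ * ((Gᴴ * X * G) * G') := by
        rw [hN, hP]; simp only [conjTranspose_mul, Matrix.mul_assoc]
      rw [this]
      exact (rank_mul_le_right _ _).trans (rank_mul_le_left _ _)
    · have : Gᴴ * X * G = Gᴴ * (N * G) := by
        conv_lhs => rw [← hPG]
        rw [hN]; simp only [conjTranspose_mul, Matrix.mul_assoc]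
      rw [this]
      exact (rank_mul_le_right _ _).trans (rank_mul_le_left _ _)
  set Z := LinearMap.ker N.mulVecLin ⊓ LinearMap.ker R.mulVecLin with hZ
  have hZP : ∀ z ∈ Z, P *ᵥ z = z := by
    rintro z ⟨-, hz⟩
    have hz' : R *ᵥ z = 0 := hz
    rw [hR, sub_mulVec, one_mulVec, sub_eq_zero] at hz'
    exact hz'.symm
  have hRrank := rank_one_sub_mul_generalized_inverse h
  rw [← hP, ← hR] at hRrank
  -- Since `N * R = 0`, `R` maps the kernel of `N` onto its whole range, with kernel `Z`.
  have hZdim : Module.finrank ℂ Z + R.rank + N.rank ≤ Fintype.card ι := by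
    have h1 := LinearMap.finrank_range_add_finrank_ker
      (R.mulVecLin.domRestrict (LinearMap.ker N.mulVecLin))
    have hNR : N * R = 0 := by rw [← hNP, Matrix.mul_assoc, hPR, Matrix.mul_zero]
    have h2 : R.rank ≤ Module.finrank ℂ (LinearMap.range
        (R.mulVecLin.domRestrict (LinearMap.ker N.mulVecLin))) := by
      refine Submodule.finrank_mono ?_
      rintro _ ⟨x, rfl⟩
      refine ⟨⟨R *ᵥ x, ?_⟩, ?_⟩
      · change N *ᵥ R *ᵥ x = 0
        rw [mulVec_mulVec, hNR, zero_mulVec]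
      · change R *ᵥ R *ᵥ x = R *ᵥ x
        rw [mulVec_mulVec, hRR]
    have h3 : Module.finrank ℂ Z ≤ Module.finrank ℂ (LinearMap.ker
        (R.mulVecLin.domRestrict (LinearMap.ker N.mulVecLin))) := by
      rw [← Submodule.finrank_map_subtype_eq]
      refine Submodule.finrank_mono ?_
      rintro x ⟨hx, hx'⟩
      exact ⟨⟨x, hx⟩, hx', rfl⟩
    have h4 := rank_add_finrank_ker N
    omega
  obtain ⟨T, hTW, hTZ, hTrank⟩ := exists_matrix_map_eq_range Z (LinearMap.range R.mulVecLin)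
  set Y := N + (Pᴴ * Tᴴ * R + Rᴴ * T * P) + Rᴴ * R with hY
  have hker : LinearMap.ker Y.mulVecLin ≤ Z ⊓ LinearMap.ker T.mulVecLin := by
    intro v hv
    have hv0 : Y *ᵥ v = 0 := hv
    have hexp : Y *ᵥ v = N *ᵥ v + Pᴴ *ᵥ Tᴴ *ᵥ R *ᵥ v + Rᴴ *ᵥ (T *ᵥ P *ᵥ v + R *ᵥ v) := by
      simp only [hY, add_mulVec, mulVec_add, mulVec_mulVec, Matrix.mul_assoc]
      abel
    have hRN : Rᴴ * N = 0 := by simp only [hN, ← Matrix.mul_assoc Rᴴ, hPRt, Matrix.zero_mul]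
    have h1 : Rᴴ *ᵥ (T *ᵥ P *ᵥ v + R *ᵥ v) = 0 := by
      have h2 : Rᴴ *ᵥ (Y *ᵥ v) = 0 := by rw [hv0, mulVec_zero]
      rw [hexp, mulVec_add, mulVec_add, mulVec_mulVec, hRN, mulVec_mulVec, hPRt,
        mulVec_mulVec (M := Rᴴ) (N := Rᴴ), hRRt, zero_mulVec, zero_mulVec, zero_add, zero_add] at h2
      exact h2
    -- The vector lies in the range of `R`, because `T` does, and `Rᴴ` is injective there.
    have h2 : T *ᵥ P *ᵥ v + R *ᵥ v = 0 := by
      obtain ⟨t, ht⟩ : ∃ t, R *ᵥ t = T *ᵥ P *ᵥ v + R *ᵥ v := by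
        obtain ⟨t, ht⟩ := hTW ⟨P *ᵥ v, rfl⟩
        exact ⟨t + v, by rw [mulVec_add]; congr 1⟩
      rw [← ht, mulVec_mulVec] at h1
      rw [← ht]
      exact (conjTranspose_mul_self_mulVec_eq_zero R t).1 h1
    have h3 : R *ᵥ v = -(T *ᵥ P *ᵥ v) := (neg_eq_of_add_eq_zero_right h2).symm
    have h4 : N *ᵥ v = Pᴴ *ᵥ Tᴴ *ᵥ T *ᵥ P *ᵥ v := by
      rw [hexp, h1, add_zero, h3, mulVec_neg, mulVec_neg, add_neg_eq_zero] at hv0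
      exact hv0
    -- Choose `z` in `Z` with `T z = T P v`. Pairing `z` with `h4` gives `0` on the left, since `N z
    -- = 0`, and the squared norm of `T P v` on the right, since `P z = z`.
    have h5 : T *ᵥ P *ᵥ v = 0 := by
      obtain ⟨z, hz, hzv⟩ : T *ᵥ P *ᵥ v ∈ Z.map T.mulVecLin := hTZ ▸ ⟨P *ᵥ v, rfl⟩
      have hzv' : T *ᵥ z = T *ᵥ P *ᵥ v := hzv
      have hNz : N *ᵥ z = 0 := hz.1
      have h6 : star z ⬝ᵥ N *ᵥ v = 0 := by
        rw [dotProduct_mulVec]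
        have : star z ᵥ* N = star (N *ᵥ z) := by rw [star_mulVec, hNherm.eq]
        rw [this, hNz, star_zero, zero_dotProduct]
      rw [h4, dotProduct_mulVec, ← star_mulVec, hZP z hz, dotProduct_mulVec, ← star_mulVec,
        hzv'] at h6
      exact dotProduct_star_self_eq_zero.1 h6
    have h6 : R *ᵥ v = 0 := by rw [h3, h5, neg_zero]
    have h7 : N *ᵥ v = 0 := by rw [h4, h5, mulVec_zero, mulVec_zero]
    have h8 : v ∈ Z := ⟨h7, h6⟩
    refine ⟨h8, ?_⟩
    rw [hZP v h8] at h5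
    exact h5
  have hdim : Module.finrank ℂ (Z ⊓ LinearMap.ker T.mulVecLin : Submodule ℂ (ι → ℂ)) + T.rank ≤
      Module.finrank ℂ Z := by
    have h1 := LinearMap.finrank_range_add_finrank_ker (T.mulVecLin.domRestrict Z)
    have h2 : LinearMap.range (T.mulVecLin.domRestrict Z) = LinearMap.range T.mulVecLin := by
      rw [LinearMap.range_domRestrict, hTZ]
    rw [h2] at h1
    have h3 : Module.finrank ℂ (Z ⊓ LinearMap.ker T.mulVecLin : Submodule ℂ (ι → ℂ)) ≤
        Module.finrank ℂ (LinearMap.ker (T.mulVecLin.domRestrict Z)) := by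
      rw [← Submodule.finrank_map_subtype_eq]
      refine Submodule.finrank_mono ?_
      rintro x ⟨hx, hx'⟩
      exact ⟨⟨x, hx⟩, hx', rfl⟩
    rw [Matrix.rank]
    omega
  refine ⟨Y, ?_, ?_, ?_⟩
  · refine (hNherm.add ?_).add (isHermitian_conjTranspose_mul_self R)
    rw [IsHermitian, conjTranspose_add, add_comm]
    simp only [conjTranspose_mul, conjTranspose_conjTranspose, Matrix.mul_assoc]
  · have hGRt : Gᴴ * Rᴴ = 0 := by rw [← conjTranspose_mul, hRG, conjTranspose_zero]
    have hGPt : Gᴴ * Pᴴ = Gᴴ := by rw [← conjTranspose_mul, hPG]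
    calc Gᴴ * Y * G = (Gᴴ * Pᴴ) * X * (P * G) + (Gᴴ * Pᴴ * Tᴴ * (R * G) + Gᴴ * Rᴴ * T * P * G)
          + Gᴴ * Rᴴ * R * G := by
          rw [hY, hN]; simp only [Matrix.mul_add, Matrix.add_mul, Matrix.mul_assoc]
      _ = _ := by rw [hRG, hGRt, hGPt, hPG]; simp
  · have h1 := rank_add_finrank_ker Y
    have h2 := Submodule.finrank_mono hker
    rw [← hNrank]
    have h3 : Module.finrank ℂ (LinearMap.range R.mulVecLin) = R.rank := rfl
    omega

end Extension

/-! ### Inertia of bordered matrices and elimination of the second column block. -/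

section Bordered

variable {m k n₁ n₂ : ℕ}

theorem matrix_rank_add_le {ι κ : Type*} [Fintype κ] [Fintype ι] (A B : Matrix ι κ ℂ) :
    (A + B).rank ≤ A.rank + B.rank := by
  have h : LinearMap.range (A + B).mulVecLin ≤
      LinearMap.range A.mulVecLin ⊔ LinearMap.range B.mulVecLin := by
    rintro _ ⟨x, rfl⟩
    rw [mulVecLin_add, LinearMap.add_apply]
    exact Submodule.add_mem_sup ⟨x, rfl⟩ ⟨x, rfl⟩
  exact (Submodule.finrank_mono h).trans (Submodule.finrank_add_le_finrank_add_finrank _ _)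

theorem bordered_isHermitian {A : Matrix (Fin m) (Fin m) ℂ} (hA : A.IsHermitian)
    (B : Matrix (Fin m) (Fin k) ℂ) : (bordered A B).IsHermitian :=
  hA.fromBlocks rfl (isHermitian_zero)

theorem neg_bordered (A : Matrix (Fin m) (Fin m) ℂ) (B : Matrix (Fin m) (Fin k) ℂ) :
    -bordered A B = bordered (-A) (-B) := by
  rw [bordered, bordered, fromBlocks_neg, conjTranspose_neg, neg_zero]

/-- The bordered matrix is `H` padded by zeros plus a matrix factoring through `B` and its adjoint.
This upper bound later forces equality in both inertia estimates. -/
theorem rank_bordered_le {A H : Matrix (Fin m) (Fin m) ℂ} {B : Matrix (Fin m) (Fin k) ℂ}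
    {L : Matrix (Fin k) (Fin m) ℂ} (hA : A = H + B * L + (B * L)ᴴ) :
    (bordered A B).rank ≤ H.rank + 2 * B.rank := by
  set E : Matrix (Fin m ⊕ Fin k) (Fin m) ℂ := fromRows 1 0
  set F : Matrix (Fin k) (Fin m ⊕ Fin k) ℂ := fromCols L 1
  have h : bordered A B = E * H * Eᴴ + E * B * F + (E * B * F)ᴴ := by
    have h1 : E * H * Eᴴ = fromBlocks H 0 0 0 := by
      rw [conjTranspose_fromRows_eq_fromCols_conjTranspose, fromRows_mul, fromRows_mul_fromCols]
      simp
    have h2 : E * B * F = fromBlocks (B * L) B 0 0 := by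
      rw [fromRows_mul, fromRows_mul_fromCols]
      simp
    rw [h1, h2, fromBlocks_conjTranspose, fromBlocks_add, fromBlocks_add, bordered, hA]
    simp
  have h1 : (E * B * F).rank ≤ B.rank := (rank_mul_le_left _ _).trans (rank_mul_le_right _ _)
  have h2 : (E * H * Eᴴ).rank ≤ H.rank := (rank_mul_le_left _ _).trans (rank_mul_le_right _ _)
  have h3 := matrix_rank_add_le (E * H * Eᴴ + E * B * F) (E * B * F)ᴴ
  have h4 := matrix_rank_add_le (E * H * Eᴴ) (E * B * F)
  rw [rank_conjTranspose] at h3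
  rw [h]
  omega

/-- The border is a hyperbolic form, which has `B.rank` positive directions independent of `H`. The
matrix `K` clears `L` and exhibits `H ⊕ B * Bᴴ` as a compression of the bordered matrix. -/
theorem posInertia_add_rank_le_bordered {A H P Q : Matrix (Fin m) (Fin m) ℂ}
    {B : Matrix (Fin m) (Fin k) ℂ} {L : Matrix (Fin k) (Fin m) ℂ} (hAh : A.IsHermitian)
    (hH : H.IsHermitian) (hQB : Q * B = 0) (hPB : P * B = B) (hQH : Q * H = H) (hPH : P * H = 0)
    (hA : A = H + B * L + (B * L)ᴴ) :
    posInertia H + B.rank ≤ posInertia (bordered A B) := by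
  obtain ⟨C, hC⟩ : ∃ C : Matrix (Fin m) (Fin k) ℂ, B * Cᴴ + C * Bᴴ = B * Bᴴ := by
    -- With half of `B`, the two symmetric cross terms add up to the semidefinite matrix `B * Bᴴ`.
    refine ⟨(2⁻¹ : ℂ) • B, ?_⟩
    rw [conjTranspose_smul, Matrix.mul_smul, Matrix.smul_mul, ← add_smul]
    norm_num
  have hHQ : H * Qᴴ = H := by
    have := congrArg conjTranspose hQH
    rwa [conjTranspose_mul, hH.eq] at this
  have hHP : H * Pᴴ = 0 := by
    have := congrArg conjTranspose hPH
    rwa [conjTranspose_mul, hH.eq, conjTranspose_zero] at this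
  have hBQ : Bᴴ * Qᴴ = 0 := by rw [← conjTranspose_mul, hQB, conjTranspose_zero]
  have hBP : Bᴴ * Pᴴ = Bᴴ := by rw [← conjTranspose_mul, hPB]
  set K : Matrix (Fin m ⊕ Fin k) (Fin m ⊕ Fin m) ℂ :=
    fromBlocks Qᴴ Pᴴ (-(L * Qᴴ)) (Cᴴ - L * Pᴴ) with hK
  have hMK : bordered A B * K = fromBlocks H (Lᴴ * Bᴴ + B * Cᴴ) 0 Bᴴ := by
    rw [bordered, hK, fromBlocks_multiply, hA, conjTranspose_mul]
    congr 1
    · simp only [Matrix.add_mul, Matrix.mul_neg, Matrix.mul_assoc, hHQ, hBQ, Matrix.mul_zero]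
      abel
    · simp only [Matrix.add_mul, Matrix.mul_sub, Matrix.mul_assoc, hHP, hBP]
      abel
    · rw [hBQ, Matrix.zero_mul, add_zero]
    · rw [hBP, Matrix.zero_mul, add_zero]
  have hKMK : Kᴴ * bordered A B * K = fromBlocks H 0 0 (B * Bᴴ) := by
    rw [Matrix.mul_assoc, hMK, hK, fromBlocks_conjTranspose, fromBlocks_multiply]
    simp only [conjTranspose_neg, conjTranspose_sub, conjTranspose_mul, conjTranspose_conjTranspose]
    congr 1
    · rw [hQH, Matrix.mul_zero, add_zero]
    · rw [Matrix.mul_add, ← Matrix.mul_assoc Q B, hQB, Matrix.neg_mul, Matrix.mul_assoc]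
      simp
    · rw [hPH, Matrix.mul_zero, add_zero]
    · rw [← hC, Matrix.mul_add, ← Matrix.mul_assoc P B, hPB, Matrix.sub_mul, Matrix.mul_assoc P]
      abel
  have h := posInertia_conj_le (bordered_isHermitian hAh B) K
  rwa [hKMK, posInertia_fromBlocks_diagonal,
    (posSemidef_self_mul_conjTranspose B).posInertia_eq_rank, rank_self_mul_conjTranspose] at h

/-- Both indices are at least those of the compression plus `B.rank`, while their sum, the rank,
exceeds its rank by at most `2 * B.rank`; so both bounds are equalities. -/
theorem inertia_bordered {A : Matrix (Fin m) (Fin m) ℂ} (hAh : A.IsHermitian)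
    {B : Matrix (Fin m) (Fin k) ℂ} {B' : Matrix (Fin k) (Fin m) ℂ} (hB : B * B' * B = B) :
    posInertia (bordered A B) =
        posInertia ((1 - B * B') * A * (1 - B * B')ᴴ) + B.rank ∧
      negInertia (bordered A B) =
        negInertia ((1 - B * B') * A * (1 - B * B')ᴴ) + B.rank := by
  set P := B * B' with hP
  set Q := 1 - P with hQ
  set H := Q * A * Qᴴ with hHdef
  have hH : H.IsHermitian := isHermitian_mul_mul_conjTranspose Q hAh
  have hQB : Q * B = 0 := by rw [hQ, Matrix.sub_mul, Matrix.one_mul, hB, sub_self]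
  have hPP : P * P = P := by rw [hP, ← Matrix.mul_assoc, hB]
  have hPQ : P * Q = 0 := by rw [hQ, Matrix.mul_sub, Matrix.mul_one, hPP, sub_self]
  have hQQ : Q * Q = Q := by
    nth_rw 1 [hQ]
    rw [Matrix.sub_mul, Matrix.one_mul, hPQ, sub_zero]
  have hQH : Q * H = H := by simp only [hHdef, ← Matrix.mul_assoc, hQQ]
  have hPH : P * H = 0 := by simp only [hHdef, ← Matrix.mul_assoc, hPQ, Matrix.zero_mul]
  obtain ⟨L, hL⟩ : ∃ L : Matrix (Fin k) (Fin m) ℂ, A = H + B * L + (B * L)ᴴ := by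
    -- `A - H` equals `P * A + A * Pᴴ - P * A * Pᴴ`; halving the last term shares it equally between
    -- `B * L` and its adjoint.
    refine ⟨B' * A - (2⁻¹ : ℂ) • (B' * A * Pᴴ), ?_⟩
    have h1 : B * (B' * A - (2⁻¹ : ℂ) • (B' * A * Pᴴ)) =
        P * A - (2⁻¹ : ℂ) • (P * A * Pᴴ) := by
      simp only [Matrix.mul_sub, Matrix.mul_smul, ← Matrix.mul_assoc, ← hP]
    have h2 : (2⁻¹ : ℂ) • (P * A * Pᴴ) + (2⁻¹ : ℂ) • (P * A * Pᴴ) = P * A * Pᴴ := by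
      rw [← add_smul]; norm_num
    have h3 : H = A - P * A - A * Pᴴ + P * A * Pᴴ := by
      rw [hHdef, hQ, conjTranspose_sub, conjTranspose_one]
      simp only [Matrix.mul_sub, Matrix.sub_mul, Matrix.one_mul, Matrix.mul_one]
      abel
    have h4 : star (2⁻¹ : ℂ) = 2⁻¹ := by simp
    have h5 : (P * A)ᴴ = A * Pᴴ := by rw [conjTranspose_mul, hAh.eq]
    have h6 : (P * A * Pᴴ)ᴴ = P * A * Pᴴ := isHermitian_mul_mul_conjTranspose P hAh
    rw [h1, conjTranspose_sub, conjTranspose_smul, h4, h5, h6, h3]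
    nth_rw 1 [← h2]
    abel
  have hp := posInertia_add_rank_le_bordered hAh hH hQB hB hQH hPH hL
  have hn := posInertia_add_rank_le_bordered (B := -B) (A := -A) (H := -H) (L := L) (P := P)
    (Q := Q) hAh.neg hH.neg (by rw [Matrix.mul_neg, hQB, neg_zero])
    (by rw [Matrix.mul_neg, hB]) (by rw [Matrix.mul_neg, hQH])
    (by rw [Matrix.mul_neg, hPH, neg_zero])
    (by nth_rw 1 [hL]; rw [Matrix.neg_mul, conjTranspose_neg]; abel)
  have hr := rank_bordered_le hL
  have hb := bordered_isHermitian hAh B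
  rw [← neg_bordered, posInertia_neg hb, posInertia_neg hH] at hn
  have hneg : B.rank ≤ (-B).rank := by
    have h : B = -B * (-1 : Matrix (Fin k) (Fin k) ℂ) := by simp
    conv_lhs => rw [h]
    exact rank_mul_le_left _ _
  rw [rank_eq_posInertia_add_negInertia hb, rank_eq_posInertia_add_negInertia hH] at hr
  omega

/-- Necessity comes from multiplying by `Q`, which kills `B₂`. For sufficiency, a known solution is
corrected so that its first block becomes `X₁` while the product is unchanged. -/
theorem mem_solBlocks₁_iff {A : Matrix (Fin m) (Fin m) ℂ}
    {B₁ : Matrix (Fin m) (Fin n₁) ℂ} {B₂ : Matrix (Fin m) (Fin n₂) ℂ}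
    {B' : Matrix (Fin n₂) (Fin m) ℂ} (hB : B₂ * B' * B₂ = B₂)
    (hcons : (hermSolutions A B₁ B₂).Nonempty) (X₁ : Matrix (Fin n₁) (Fin n₁) ℂ) :
    X₁ ∈ solBlocks₁ A B₁ B₂ ↔ X₁.IsHermitian ∧
      ((1 - B₂ * B') * B₁) * X₁ * ((1 - B₂ * B') * B₁)ᴴ =
        (1 - B₂ * B') * A * (1 - B₂ * B')ᴴ := by
  set P := B₂ * B' with hP
  set Q := 1 - P with hQ
  have hQB : Q * B₂ = 0 := by rw [hQ, Matrix.sub_mul, Matrix.one_mul, hB, sub_self]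
  have key : ∀ X ∈ hermSolutions A B₁ B₂, X.toBlocks₁₁.IsHermitian ∧
      (Q * B₁) * X.toBlocks₁₁ * (Q * B₁)ᴴ = Q * A * Qᴴ := by
    rintro X ⟨hX, hXA⟩
    refine ⟨hX.submatrix Sum.inl, ?_⟩
    set E : Matrix (Fin m) (Fin n₁ ⊕ Fin n₂) ℂ := fromCols B₁ B₂
    set F : Matrix (Fin m) (Fin n₁ ⊕ Fin n₂) ℂ := fromCols (Q * B₁) 0 with hF
    have h1 : Q * E = F := by rw [mul_fromCols, hQB]
    calc (Q * B₁) * X.toBlocks₁₁ * (Q * B₁)ᴴ = F * X * Fᴴ := by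
          conv_rhs => rw [← fromBlocks_toBlocks X]
          rw [hF, fromCols_mul_fromBlocks, conjTranspose_fromCols_eq_fromRows_conjTranspose,
            fromCols_mul_fromRows]
          simp
      _ = Q * A * Qᴴ := by
          rw [← h1, ← hXA, conjTranspose_mul]
          simp only [Matrix.mul_assoc]
  constructor
  · rintro ⟨X, hX, rfl⟩
    exact key X hX
  · rintro ⟨hX₁, hX₁A⟩
    obtain ⟨X, hX⟩ := hcons
    obtain ⟨h1, h2⟩ := key X hX
    set D := X₁ - X.toBlocks₁₁ with hD
    have hDh : D.IsHermitian := hX₁.sub h1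
    have hDQ : Q * (B₁ * D * B₁ᴴ) * Qᴴ = 0 := by
      have : Q * (B₁ * D * B₁ᴴ) * Qᴴ = (Q * B₁) * D * (Q * B₁)ᴴ := by
        simp only [conjTranspose_mul, Matrix.mul_assoc]
      rw [this, hD, Matrix.mul_sub, Matrix.sub_mul, hX₁A, h2, sub_self]
    set J := B' * B₁ with hJ
    -- This is `[1; -J] D [1; -J]ᴴ`. As `B₁ - B₂ * J = Q * B₁`, its contribution to the equation is
    -- `Q B₁ D B₁ᴴ Qᴴ`, which vanishes by `hDQ`.
    set Y : Matrix (Fin n₁ ⊕ Fin n₂) (Fin n₁ ⊕ Fin n₂) ℂ :=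
      fromBlocks D (-(D * Jᴴ)) (-(J * D)) (J * D * Jᴴ) with hY
    have hYh : Y.IsHermitian := by
      refine hDh.fromBlocks ?_ (isHermitian_mul_mul_conjTranspose J hDh)
      rw [conjTranspose_neg, conjTranspose_mul, conjTranspose_conjTranspose, hDh.eq]
    refine ⟨X + Y, ⟨hX.1.add hYh, ?_⟩, ?_⟩
    · have hY0 : fromCols B₁ B₂ * Y * (fromCols B₁ B₂)ᴴ = Q * (B₁ * D * B₁ᴴ) * Qᴴ := by
        have hPB : B₂ * J = P * B₁ := by rw [hJ, hP, Matrix.mul_assoc]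
        have hPBt : Jᴴ * B₂ᴴ = B₁ᴴ * Pᴴ := by rw [← conjTranspose_mul, hPB, conjTranspose_mul]
        rw [hY, fromCols_mul_fromBlocks, conjTranspose_fromCols_eq_fromRows_conjTranspose,
            fromCols_mul_fromRows, hQ, conjTranspose_sub, conjTranspose_one]
        simp only [Matrix.mul_sub, Matrix.sub_mul, Matrix.add_mul, Matrix.one_mul, Matrix.mul_one,
          Matrix.mul_neg, Matrix.neg_mul, Matrix.mul_assoc, hPBt]
        simp only [← Matrix.mul_assoc, hPB]
        abel
      rw [Matrix.mul_add, Matrix.add_mul, hX.2, hY0, hDQ, add_zero]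
    · change X.toBlocks₁₁ + Y.toBlocks₁₁ = X₁
      rw [hY, toBlocks_fromBlocks₁₁, hD]
      abel

theorem range_fromCols (B₁ : Matrix (Fin m) (Fin n₁) ℂ) (B₂ : Matrix (Fin m) (Fin n₂) ℂ) :
    LinearMap.range (fromCols B₁ B₂).mulVecLin =
      LinearMap.range B₁.mulVecLin ⊔ LinearMap.range B₂.mulVecLin := by
  apply le_antisymm
  · rintro _ ⟨x, rfl⟩
    rw [mulVecLin_apply, fromCols_mulVec]
    exact Submodule.add_mem_sup ⟨_, rfl⟩ ⟨_, rfl⟩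
  · refine sup_le ?_ ?_
    · rintro _ ⟨x, rfl⟩
      exact ⟨Sum.elim x 0, by simp [fromCols_mulVec]⟩
    · rintro _ ⟨x, rfl⟩
      exact ⟨Sum.elim 0 x, by simp [fromCols_mulVec]⟩

/-- Rank–nullity for `Q` restricted to the range of `[B₁, B₂]`: the image is the range of `Q * B₁`
and the kernel is the range of `B₂`. -/
theorem rank_fromCols_eq {B₁ : Matrix (Fin m) (Fin n₁) ℂ} {B₂ : Matrix (Fin m) (Fin n₂) ℂ}
    {B' : Matrix (Fin n₂) (Fin m) ℂ} (hB : B₂ * B' * B₂ = B₂) :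
    (fromCols B₁ B₂).rank = ((1 - B₂ * B') * B₁).rank + B₂.rank := by
  set Q := 1 - B₂ * B' with hQ
  have hQB : Q * B₂ = 0 := by rw [hQ, Matrix.sub_mul, Matrix.one_mul, hB, sub_self]
  set V := LinearMap.range (fromCols B₁ B₂).mulVecLin with hV
  have h1 := LinearMap.finrank_range_add_finrank_ker (Q.mulVecLin.domRestrict V)
  have h2 : LinearMap.range (Q.mulVecLin.domRestrict V) = LinearMap.range (Q * B₁).mulVecLin := by
    rw [LinearMap.range_domRestrict, hV, range_fromCols, Submodule.map_sup,
      ← LinearMap.range_comp, ← LinearMap.range_comp, ← mulVecLin_mul, ← mulVecLin_mul, hQB,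
      mulVecLin_zero, LinearMap.range_zero, sup_bot_eq]
  have h3 : (LinearMap.ker (Q.mulVecLin.domRestrict V)).map V.subtype =
      LinearMap.range B₂.mulVecLin := by
    apply le_antisymm
    · rintro _ ⟨x, hx, rfl⟩
      have hx' : Q *ᵥ x.1 = 0 := hx
      rw [hQ, sub_mulVec, one_mulVec, sub_eq_zero, ← mulVec_mulVec] at hx'
      exact ⟨_, hx'.symm⟩
    · rintro _ ⟨y, rfl⟩
      refine ⟨⟨B₂ *ᵥ y, ?_⟩, ?_, rfl⟩
      · rw [hV, range_fromCols]
        exact Submodule.mem_sup_right ⟨y, rfl⟩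
      · change Q *ᵥ B₂ *ᵥ y = 0
        rw [mulVec_mulVec, hQB, zero_mulVec]
  have h4 := Submodule.finrank_map_subtype_eq V (LinearMap.ker (Q.mulVecLin.domRestrict V))
  rw [h3] at h4
  rw [h2, ← h4] at h1
  exact h1.symm

theorem rank_fromCols_eq_add_iff (B₁ : Matrix (Fin m) (Fin n₁) ℂ)
    (B₂ : Matrix (Fin m) (Fin n₂) ℂ) :
    (fromCols B₁ B₂).rank = n₁ + B₂.rank ↔
      LinearMap.range B₁.mulVecLin ⊓ LinearMap.range B₂.mulVecLin = ⊥ ∧ B₁.rank = n₁ := by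
  have h1 := Submodule.finrank_sup_add_finrank_inf_eq (LinearMap.range B₁.mulVecLin)
    (LinearMap.range B₂.mulVecLin)
  rw [← range_fromCols] at h1
  change (fromCols B₁ B₂).rank + _ = B₁.rank + B₂.rank at h1
  have h2 : B₁.rank ≤ n₁ := rank_le_width B₁
  rw [← Submodule.finrank_eq_zero (R := ℂ)]
  omega

end Bordered

/-! ### Extremal values over the solution blocks, and the exchange of the two blocks. -/

section SolutionBlocks

variable {m n₁ n₂ : ℕ}

theorem solBlocks₁_inertia_bounds {A : Matrix (Fin m) (Fin m) ℂ} (hA : A.IsHermitian)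
    {B₁ : Matrix (Fin m) (Fin n₁) ℂ} {B₂ : Matrix (Fin m) (Fin n₂) ℂ}
    (hcons : (hermSolutions A B₁ B₂).Nonempty) :
    ∀ X₁ ∈ solBlocks₁ A B₁ B₂, X₁.IsHermitian ∧
      posInertia (bordered A B₂) ≤ posInertia X₁ + B₂.rank ∧
      posInertia X₁ + (fromCols B₁ B₂).rank ≤ posInertia (bordered A B₂) + n₁ ∧
      negInertia (bordered A B₂) ≤ negInertia X₁ + B₂.rank ∧
      negInertia X₁ + (fromCols B₁ B₂).rank ≤ negInertia (bordered A B₂) + n₁ := by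
  obtain ⟨B', hB, -⟩ := exists_generalized_inverse B₂
  intro X₁ hX₁
  obtain ⟨hX, hXA⟩ := (mem_solBlocks₁_iff hB hcons X₁).1 hX₁
  obtain ⟨h1, h2⟩ := inertia_bordered hA hB
  rw [h1, h2, rank_fromCols_eq hB, ← hXA]
  set C := (1 - B₂ * B') * B₁
  have h3 := posInertia_add_rank_le hX Cᴴ
  have h4 := posInertia_conj_le hX Cᴴ
  have h5 := negInertia_add_rank_le hX Cᴴ
  have h6 := negInertia_conj_le hX Cᴴ
  rw [conjTranspose_conjTranspose] at h3 h4 h5 h6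
  rw [rank_conjTranspose, Fintype.card_fin] at h3 h5
  refine ⟨hX, ?_, ?_, ?_, ?_⟩ <;> omega

/-- A single block minimizes both indices, hence also the rank. The two maxima may need different
blocks, and the maximal rank needs its own construction, being capped by `n₁`. -/
theorem exists_mem_solBlocks₁_extremal {A : Matrix (Fin m) (Fin m) ℂ} (hA : A.IsHermitian)
    {B₁ : Matrix (Fin m) (Fin n₁) ℂ} {B₂ : Matrix (Fin m) (Fin n₂) ℂ}
    (hcons : (hermSolutions A B₁ B₂).Nonempty) :
    (∃ X₁ ∈ solBlocks₁ A B₁ B₂, posInertia X₁ + B₂.rank = posInertia (bordered A B₂) ∧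
      negInertia X₁ + B₂.rank = negInertia (bordered A B₂)) ∧
    (∃ X₁ ∈ solBlocks₁ A B₁ B₂,
      posInertia X₁ + (fromCols B₁ B₂).rank = posInertia (bordered A B₂) + n₁) ∧
    (∃ X₁ ∈ solBlocks₁ A B₁ B₂,
      negInertia X₁ + (fromCols B₁ B₂).rank = negInertia (bordered A B₂) + n₁) ∧
    (∃ X₁ ∈ solBlocks₁ A B₁ B₂, min (n₁ + 2 * (fromCols B₁ B₂).rank)
      ((bordered A B₂).rank + 2 * n₁) ≤ X₁.rank + 2 * (fromCols B₁ B₂).rank) := by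
  obtain ⟨B', hB, -⟩ := exists_generalized_inverse B₂
  obtain ⟨X, hX⟩ := hcons
  obtain ⟨hX0, hXA⟩ := (mem_solBlocks₁_iff hB ⟨X, hX⟩ _).1 ⟨X, hX, rfl⟩
  obtain ⟨h1, h2⟩ := inertia_bordered hA hB
  have hH := isHermitian_mul_mul_conjTranspose (1 - B₂ * B') hA
  have h3 : (bordered A B₂).rank =
      ((1 - B₂ * B') * A * (1 - B₂ * B')ᴴ).rank + 2 * B₂.rank := by
    rw [rank_eq_posInertia_add_negInertia (bordered_isHermitian hA B₂),
      rank_eq_posInertia_add_negInertia hH]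
    omega
  have hmem : ∀ Y : Matrix (Fin n₁) (Fin n₁) ℂ, Y.IsHermitian →
      ((1 - B₂ * B') * B₁) * Y * ((1 - B₂ * B') * B₁)ᴴ =
        (1 - B₂ * B') * A * (1 - B₂ * B')ᴴ → Y ∈ solBlocks₁ A B₁ B₂ :=
    fun Y hY hYA => (mem_solBlocks₁_iff hB ⟨X, hX⟩ Y).2 ⟨hY, hYA⟩
  rw [h1, h2, h3, rank_fromCols_eq hB]
  set C := (1 - B₂ * B') * B₁
  have e1 := exists_extension_min_inertia hX0 Cᴴ
  have e2 := exists_extension_max_posInertia hX0 Cᴴ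
  have e3 := exists_extension_max_negInertia hX0 Cᴴ
  have e4 := exists_extension_max_rank hX0 Cᴴ
  rw [conjTranspose_conjTranspose, hXA] at e1 e2 e3 e4
  rw [rank_conjTranspose, Fintype.card_fin] at e2 e3 e4
  refine ⟨?_, ?_, ?_, ?_⟩
  · obtain ⟨Y, hY, hYA, hp, hn⟩ := e1
    exact ⟨Y, hmem Y hY hYA, by omega, by omega⟩
  · obtain ⟨Y, hY, hYA, hp⟩ := e2
    exact ⟨Y, hmem Y hY hYA, by omega⟩
  · obtain ⟨Y, hY, hYA, hp⟩ := e3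
    exact ⟨Y, hmem Y hY hYA, by omega⟩
  · obtain ⟨Y, hY, hYA, hp⟩ := e4
    exact ⟨Y, hmem Y hY hYA, by omega⟩

theorem solBlocks₁_extremal {A : Matrix (Fin m) (Fin m) ℂ} (hA : A.IsHermitian)
    {B₁ : Matrix (Fin m) (Fin n₁) ℂ} {B₂ : Matrix (Fin m) (Fin n₂) ℂ}
    (hcons : (hermSolutions A B₁ B₂).Nonempty) :
    IsGreatest ((fun X₁ => (X₁.rank : ℤ)) '' solBlocks₁ A B₁ B₂)
      (min (n₁ : ℤ) ((bordered A B₂).rank - 2 * (fromCols B₁ B₂).rank + 2 * n₁)) ∧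
    IsLeast ((fun X₁ => (X₁.rank : ℤ)) '' solBlocks₁ A B₁ B₂)
      ((bordered A B₂).rank - 2 * B₂.rank) ∧
    IsGreatest ((fun X₁ => (posInertia X₁ : ℤ)) '' solBlocks₁ A B₁ B₂)
      (posInertia (bordered A B₂) - (fromCols B₁ B₂).rank + n₁) ∧
    IsGreatest ((fun X₁ => (negInertia X₁ : ℤ)) '' solBlocks₁ A B₁ B₂)
      (negInertia (bordered A B₂) - (fromCols B₁ B₂).rank + n₁) ∧
    IsLeast ((fun X₁ => (posInertia X₁ : ℤ)) '' solBlocks₁ A B₁ B₂)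
      (posInertia (bordered A B₂) - B₂.rank) ∧
    IsLeast ((fun X₁ => (negInertia X₁ : ℤ)) '' solBlocks₁ A B₁ B₂)
      (negInertia (bordered A B₂) - B₂.rank) := by
  have hb := solBlocks₁_inertia_bounds hA hcons
  have hrank : ∀ X₁ ∈ solBlocks₁ A B₁ B₂, X₁.rank = posInertia X₁ + negInertia X₁ :=
    fun X₁ h => rank_eq_posInertia_add_negInertia (hb X₁ h).1
  have hM := rank_eq_posInertia_add_negInertia (bordered_isHermitian hA B₂)
  obtain ⟨⟨X, hX, hXp, hXn⟩, ⟨Y, hY, hYp⟩, ⟨Z, hZ, hZn⟩, ⟨W, hW, hWr⟩⟩ :=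
    exists_mem_solBlocks₁_extremal hA hcons
  refine ⟨⟨⟨W, hW, ?_⟩, ?_⟩, ⟨⟨X, hX, ?_⟩, ?_⟩, ⟨⟨Y, hY, ?_⟩, ?_⟩, ⟨⟨Z, hZ, ?_⟩, ?_⟩,
    ⟨⟨X, hX, ?_⟩, ?_⟩, ⟨⟨X, hX, ?_⟩, ?_⟩⟩
  · have h1 := hrank W hW
    have h2 := hb W hW
    have h3 := rank_le_width W
    dsimp only
    omega
  · rintro _ ⟨V, hV, rfl⟩
    have h1 := hrank V hV
    have h2 := hb V hV
    have h3 := rank_le_width V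
    dsimp only
    omega
  · have h1 := hrank X hX
    dsimp only
    omega
  · rintro _ ⟨V, hV, rfl⟩
    have h1 := hrank V hV
    have h2 := hb V hV
    dsimp only
    omega
  · dsimp only
    omega
  · rintro _ ⟨V, hV, rfl⟩
    have h2 := hb V hV
    dsimp only
    omega
  · dsimp only
    omega
  · rintro _ ⟨V, hV, rfl⟩
    have h2 := hb V hV
    dsimp only
    omega
  · dsimp only
    omega
  · rintro _ ⟨V, hV, rfl⟩
    have h2 := hb V hV
    dsimp only
    omega
  · dsimp only
    omega
  · rintro _ ⟨V, hV, rfl⟩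
    have h2 := hb V hV
    dsimp only
    omega

theorem fromCols_submatrix_swap (B₁ : Matrix (Fin m) (Fin n₁) ℂ)
    (B₂ : Matrix (Fin m) (Fin n₂) ℂ) :
    (fromCols B₁ B₂).submatrix id (Equiv.sumComm (Fin n₂) (Fin n₁)) = fromCols B₂ B₁ := by
  ext i (j | j) <;> rfl

theorem rank_fromCols_comm (B₁ : Matrix (Fin m) (Fin n₁) ℂ) (B₂ : Matrix (Fin m) (Fin n₂) ℂ) :
    (fromCols B₂ B₁).rank = (fromCols B₁ B₂).rank := by
  rw [← fromCols_submatrix_swap B₁ B₂]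
  exact rank_submatrix _ (Equiv.refl _) _

theorem submatrix_swap_mem_hermSolutions {A : Matrix (Fin m) (Fin m) ℂ}
    {B₁ : Matrix (Fin m) (Fin n₁) ℂ} {B₂ : Matrix (Fin m) (Fin n₂) ℂ}
    {X : Matrix (Fin n₁ ⊕ Fin n₂) (Fin n₁ ⊕ Fin n₂) ℂ} (hX : X ∈ hermSolutions A B₁ B₂) :
    X.submatrix (Equiv.sumComm (Fin n₂) (Fin n₁)) (Equiv.sumComm (Fin n₂) (Fin n₁)) ∈
      hermSolutions A B₂ B₁ := by
  refine ⟨hX.1.submatrix _, ?_⟩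
  rw [← fromCols_submatrix_swap B₁ B₂, conjTranspose_submatrix, submatrix_mul_equiv,
    submatrix_mul_equiv, submatrix_id_id, hX.2]

theorem solBlocks₃_eq (A : Matrix (Fin m) (Fin m) ℂ)
    (B₁ : Matrix (Fin m) (Fin n₁) ℂ) (B₂ : Matrix (Fin m) (Fin n₂) ℂ) :
    solBlocks₃ A B₁ B₂ = solBlocks₁ A B₂ B₁ := by
  ext V
  constructor
  · rintro ⟨X, hX, rfl⟩
    exact ⟨_, submatrix_swap_mem_hermSolutions hX, rfl⟩
  · rintro ⟨X, hX, rfl⟩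
    exact ⟨_, submatrix_swap_mem_hermSolutions hX, rfl⟩

theorem exists_hermSolutions_iff {A : Matrix (Fin m) (Fin m) ℂ}
    {B₁ : Matrix (Fin m) (Fin n₁) ℂ} {B₂ : Matrix (Fin m) (Fin n₂) ℂ}
    {p q : Matrix (Fin n₁) (Fin n₁) ℂ → Prop} (h : ∀ X₁ ∈ solBlocks₁ A B₁ B₂, (p X₁ ↔ q X₁)) :
    (∃ X ∈ hermSolutions A B₁ B₂, p X.toBlocks₁₁) ↔ ∃ X₁ ∈ solBlocks₁ A B₁ B₂, q X₁ :=
  ⟨fun ⟨X, hX, hp⟩ => ⟨_, ⟨X, hX, rfl⟩, (h _ ⟨X, hX, rfl⟩).1 hp⟩,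
    by rintro ⟨_, ⟨X, hX, rfl⟩, hq⟩; exact ⟨X, hX, (h _ ⟨X, hX, rfl⟩).2 hq⟩⟩

theorem forall_hermSolutions_iff {A : Matrix (Fin m) (Fin m) ℂ}
    {B₁ : Matrix (Fin m) (Fin n₁) ℂ} {B₂ : Matrix (Fin m) (Fin n₂) ℂ}
    {p q : Matrix (Fin n₁) (Fin n₁) ℂ → Prop} (h : ∀ X₁ ∈ solBlocks₁ A B₁ B₂, (p X₁ ↔ q X₁)) :
    (∀ X ∈ hermSolutions A B₁ B₂, p X.toBlocks₁₁) ↔ ∀ X₁ ∈ solBlocks₁ A B₁ B₂, q X₁ :=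
  ⟨by rintro H _ ⟨X, hX, rfl⟩; exact (h _ ⟨X, hX, rfl⟩).1 (H X hX),
    fun H X hX => (h _ ⟨X, hX, rfl⟩).2 (H _ ⟨X, hX, rfl⟩)⟩

/-! ### From extremal values to existence and universality criteria. -/

theorem exists_eq_max_iff {α : Type*} {S : Set α} {f : α → ℕ} {b : ℤ} {n : ℕ}
    (h : IsGreatest ((fun x => (f x : ℤ)) '' S) b) (hn : ∀ x ∈ S, f x ≤ n) :
    (∃ x ∈ S, f x = n) ↔ b = n := by
  obtain ⟨⟨y, hy, hyb⟩, hb⟩ := h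
  constructor
  · rintro ⟨x, hx, hxn⟩
    have h1 : (f x : ℤ) ≤ b := hb ⟨x, hx, rfl⟩
    have h2 := hn y hy
    dsimp only at hyb
    omega
  · intro h1
    dsimp only at hyb
    exact ⟨y, hy, by omega⟩

theorem forall_eq_min_iff {α : Type*} {S : Set α} {f : α → ℕ} {b : ℤ} {n : ℕ}
    (h : IsLeast ((fun x => (f x : ℤ)) '' S) b) (hn : ∀ x ∈ S, f x ≤ n) :
    (∀ x ∈ S, f x = n) ↔ b = n := by
  obtain ⟨⟨y, hy, hyb⟩, hb⟩ := h
  dsimp only at hyb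
  constructor
  · intro H
    rw [← hyb, H y hy]
  · intro h1 x hx
    have h1 : b ≤ (f x : ℤ) := hb ⟨x, hx, rfl⟩
    have h2 := hn x hx
    omega

theorem exists_eq_zero_iff {α : Type*} {S : Set α} {f : α → ℕ} {b : ℤ}
    (h : IsLeast ((fun x => (f x : ℤ)) '' S) b) : (∃ x ∈ S, f x = 0) ↔ b = 0 := by
  obtain ⟨⟨y, hy, hyb⟩, hb⟩ := h
  dsimp only at hyb
  constructor
  · rintro ⟨x, hx, hx0⟩
    have h1 : b ≤ (f x : ℤ) := hb ⟨x, hx, rfl⟩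
    omega
  · intro h1
    exact ⟨y, hy, by omega⟩

theorem forall_eq_zero_iff {α : Type*} {S : Set α} {f : α → ℕ} {b : ℤ}
    (h : IsGreatest ((fun x => (f x : ℤ)) '' S) b) : (∀ x ∈ S, f x = 0) ↔ b = 0 := by
  obtain ⟨⟨y, hy, hyb⟩, hb⟩ := h
  dsimp only at hyb
  constructor
  · intro H
    rw [← hyb, H y hy, Nat.cast_zero]
  · intro h1 x hx
    have h1 : (f x : ℤ) ≤ b := hb ⟨x, hx, rfl⟩
    omega

theorem forall_forall_eq_iff {α : Type*} {S : Set α} {f : α → ℕ} {a b : ℤ}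
    (ha : IsLeast ((fun x => (f x : ℤ)) '' S) a) (hb : IsGreatest ((fun x => (f x : ℤ)) '' S) b) :
    (∀ x ∈ S, ∀ y ∈ S, f x = f y) ↔ a = b := by
  obtain ⟨⟨u, hu, hua⟩, ha⟩ := ha
  obtain ⟨⟨v, hv, hvb⟩, hb⟩ := hb
  dsimp only at hua hvb
  constructor
  · intro H
    rw [← hua, ← hvb, H u hu v hv]
  · intro h x hx y hy
    have h1 : (f x : ℤ) ≤ b := hb ⟨x, hx, rfl⟩
    have h2 : (f y : ℤ) ≤ b := hb ⟨y, hy, rfl⟩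
    have h3 : a ≤ (f x : ℤ) := ha ⟨x, hx, rfl⟩
    have h4 : a ≤ (f y : ℤ) := ha ⟨y, hy, rfl⟩
    omega

end SolutionBlocks

/-! ### The main theorem. -/

theorem theorem5p2 (m n₁ n₂ : ℕ) (A : Matrix (Fin m) (Fin m) ℂ) (hA : A.IsHermitian)
    (B₁ : Matrix (Fin m) (Fin n₁) ℂ) (B₂ : Matrix (Fin m) (Fin n₂) ℂ)
    (hcons : (hermSolutions A B₁ B₂).Nonempty) :
    -- extremal ranks and inertias of `X₁`
    IsGreatest ((fun X₁ => (X₁.rank : ℤ)) '' solBlocks₁ A B₁ B₂)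
      (min (n₁ : ℤ) ((bordered A B₂).rank - 2 * (fromCols B₁ B₂).rank + 2 * n₁)) ∧
    IsLeast ((fun X₁ => (X₁.rank : ℤ)) '' solBlocks₁ A B₁ B₂)
      ((bordered A B₂).rank - 2 * B₂.rank) ∧
    IsGreatest ((fun X₁ => (posInertia X₁ : ℤ)) '' solBlocks₁ A B₁ B₂)
      (posInertia (bordered A B₂) - (fromCols B₁ B₂).rank + n₁) ∧
    IsGreatest ((fun X₁ => (negInertia X₁ : ℤ)) '' solBlocks₁ A B₁ B₂)
      (negInertia (bordered A B₂) - (fromCols B₁ B₂).rank + n₁) ∧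
    IsLeast ((fun X₁ => (posInertia X₁ : ℤ)) '' solBlocks₁ A B₁ B₂)
      (posInertia (bordered A B₂) - B₂.rank) ∧
    IsLeast ((fun X₁ => (negInertia X₁ : ℤ)) '' solBlocks₁ A B₁ B₂)
      (negInertia (bordered A B₂) - B₂.rank) ∧
    -- extremal ranks and inertias of `X₃`
    IsGreatest ((fun X₃ => (X₃.rank : ℤ)) '' solBlocks₃ A B₁ B₂)
      (min (n₂ : ℤ) ((bordered A B₁).rank - 2 * (fromCols B₁ B₂).rank + 2 * n₂)) ∧
    IsLeast ((fun X₃ => (X₃.rank : ℤ)) '' solBlocks₃ A B₁ B₂)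
      ((bordered A B₁).rank - 2 * B₁.rank) ∧
    IsGreatest ((fun X₃ => (posInertia X₃ : ℤ)) '' solBlocks₃ A B₁ B₂)
      (posInertia (bordered A B₁) - (fromCols B₁ B₂).rank + n₂) ∧
    IsGreatest ((fun X₃ => (negInertia X₃ : ℤ)) '' solBlocks₃ A B₁ B₂)
      (negInertia (bordered A B₁) - (fromCols B₁ B₂).rank + n₂) ∧
    IsLeast ((fun X₃ => (posInertia X₃ : ℤ)) '' solBlocks₃ A B₁ B₂)
      (posInertia (bordered A B₁) - B₁.rank) ∧
    IsLeast ((fun X₃ => (negInertia X₃ : ℤ)) '' solBlocks₃ A B₁ B₂)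
      (negInertia (bordered A B₁) - B₁.rank) ∧
    -- `X₁` nonsingular for some, for all solutions
    ((∃ X ∈ hermSolutions A B₁ B₂, IsUnit X.toBlocks₁₁) ↔
      (2 * (fromCols B₁ B₂).rank - n₁ : ℤ) ≤ (bordered A B₂).rank) ∧
    ((∀ X ∈ hermSolutions A B₁ B₂, IsUnit X.toBlocks₁₁) ↔
      (bordered A B₂).rank = 2 * B₂.rank + n₁) ∧
    -- `X₁ = 0` for some, for all solutions
    ((∃ X ∈ hermSolutions A B₁ B₂, X.toBlocks₁₁ = 0) ↔
      (bordered A B₂).rank = 2 * B₂.rank) ∧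
    ((∀ X ∈ hermSolutions A B₁ B₂, X.toBlocks₁₁ = 0) ↔
      ((bordered A B₂).rank : ℤ) = 2 * (fromCols B₁ B₂).rank - 2 * n₁) ∧
    -- `X₁ ≻ 0` (`X₁ ≺ 0`) for some, for all solutions
    ((∃ X ∈ hermSolutions A B₁ B₂, X.toBlocks₁₁.PosDef) ↔
      posInertia (bordered A B₂) = (fromCols B₁ B₂).rank) ∧
    ((∃ X ∈ hermSolutions A B₁ B₂, (-X.toBlocks₁₁).PosDef) ↔
      negInertia (bordered A B₂) = (fromCols B₁ B₂).rank) ∧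
    ((∀ X ∈ hermSolutions A B₁ B₂, X.toBlocks₁₁.PosDef) ↔
      posInertia (bordered A B₂) = n₁ + B₂.rank) ∧
    ((∀ X ∈ hermSolutions A B₁ B₂, (-X.toBlocks₁₁).PosDef) ↔
      negInertia (bordered A B₂) = n₁ + B₂.rank) ∧
    -- `X₁ ≽ 0` (`X₁ ≼ 0`) for some, for all solutions
    ((∃ X ∈ hermSolutions A B₁ B₂, X.toBlocks₁₁.PosSemidef) ↔
      negInertia (bordered A B₂) = B₂.rank) ∧
    ((∃ X ∈ hermSolutions A B₁ B₂, (-X.toBlocks₁₁).PosSemidef) ↔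
      posInertia (bordered A B₂) = B₂.rank) ∧
    ((∀ X ∈ hermSolutions A B₁ B₂, X.toBlocks₁₁.PosSemidef) ↔
      (negInertia (bordered A B₂) : ℤ) = (fromCols B₁ B₂).rank - n₁) ∧
    ((∀ X ∈ hermSolutions A B₁ B₂, (-X.toBlocks₁₁).PosSemidef) ↔
      (posInertia (bordered A B₂) : ℤ) = (fromCols B₁ B₂).rank - n₁) ∧
    -- invariance of the positive and of the negative index of inertia of `X₁`
    ((∀ X ∈ hermSolutions A B₁ B₂, ∀ Y ∈ hermSolutions A B₁ B₂,
        posInertia X.toBlocks₁₁ = posInertia Y.toBlocks₁₁) ↔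
      (∀ X ∈ hermSolutions A B₁ B₂, ∀ Y ∈ hermSolutions A B₁ B₂,
        negInertia X.toBlocks₁₁ = negInertia Y.toBlocks₁₁)) ∧
    ((∀ X ∈ hermSolutions A B₁ B₂, ∀ Y ∈ hermSolutions A B₁ B₂,
        negInertia X.toBlocks₁₁ = negInertia Y.toBlocks₁₁) ↔
      (LinearMap.range B₁.mulVecLin ⊓ LinearMap.range B₂.mulVecLin = ⊥ ∧ B₁.rank = n₁)) := by
  have hcons' : (hermSolutions A B₂ B₁).Nonempty := by
    obtain ⟨X, hX⟩ := hcons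
    exact ⟨_, submatrix_swap_mem_hermSolutions hX⟩
  have e₃ := solBlocks₁_extremal hA hcons'
  rw [rank_fromCols_comm, ← solBlocks₃_eq] at e₃
  obtain ⟨hrmax, hrmin, hpmax, hnmax, hpmin, hnmin⟩ := solBlocks₁_extremal hA hcons
  obtain ⟨r1, r2, r3, r4, r5, r6⟩ := e₃
  refine ⟨hrmax, hrmin, hpmax, hnmax, hpmin, hnmin, r1, r2, r3, r4, r5, r6, ?_⟩
  have hherm : ∀ X₁ ∈ solBlocks₁ A B₁ B₂, X₁.IsHermitian :=
    fun X₁ h => (solBlocks₁_inertia_bounds hA hcons X₁ h).1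
  have hrn : ∀ X₁ ∈ solBlocks₁ A B₁ B₂, X₁.rank ≤ n₁ := fun X₁ _ => rank_le_width X₁
  have hpn : ∀ X₁ ∈ solBlocks₁ A B₁ B₂, posInertia X₁ ≤ n₁ := fun X₁ h => by
    have h1 := rank_eq_posInertia_add_negInertia (hherm X₁ h)
    have h2 := hrn X₁ h
    omega
  have hnn : ∀ X₁ ∈ solBlocks₁ A B₁ B₂, negInertia X₁ ≤ n₁ := fun X₁ h => by
    have h1 := rank_eq_posInertia_add_negInertia (hherm X₁ h)
    have h2 := hrn X₁ h
    omega
  have hunit : ∀ X₁ ∈ solBlocks₁ A B₁ B₂, (IsUnit X₁ ↔ X₁.rank = n₁) := fun X₁ _ => by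
    rw [isUnit_iff_rank_eq_card, Fintype.card_fin]
  have hzero : ∀ X₁ ∈ solBlocks₁ A B₁ B₂, (X₁ = 0 ↔ X₁.rank = 0) :=
    fun X₁ _ => (matrix_rank_eq_zero_iff X₁).symm
  have hpd : ∀ X₁ ∈ solBlocks₁ A B₁ B₂, (X₁.PosDef ↔ posInertia X₁ = n₁) := fun X₁ h => by
    rw [← posInertia_eq_card_iff (hherm X₁ h), Fintype.card_fin]
  have hnd : ∀ X₁ ∈ solBlocks₁ A B₁ B₂, ((-X₁).PosDef ↔ negInertia X₁ = n₁) := fun X₁ h => by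
    rw [← negInertia_eq_card_iff (hherm X₁ h), Fintype.card_fin]
  have hps : ∀ X₁ ∈ solBlocks₁ A B₁ B₂, (X₁.PosSemidef ↔ negInertia X₁ = 0) :=
    fun X₁ h => (negInertia_eq_zero_iff (hherm X₁ h)).symm
  have hns : ∀ X₁ ∈ solBlocks₁ A B₁ B₂, ((-X₁).PosSemidef ↔ posInertia X₁ = 0) :=
    fun X₁ h => (posInertia_eq_zero_iff (hherm X₁ h)).symm
  have hconst : ∀ f : Matrix (Fin n₁) (Fin n₁) ℂ → ℕ,
      (∀ X ∈ hermSolutions A B₁ B₂, ∀ Y ∈ hermSolutions A B₁ B₂,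
        f X.toBlocks₁₁ = f Y.toBlocks₁₁) ↔
      ∀ X₁ ∈ solBlocks₁ A B₁ B₂, ∀ Y₁ ∈ solBlocks₁ A B₁ B₂, f X₁ = f Y₁ := by
    refine fun f => ⟨?_, fun H X hX Y hY => H _ ⟨X, hX, rfl⟩ _ ⟨Y, hY, rfl⟩⟩
    rintro H _ ⟨X, hX, rfl⟩ _ ⟨Y, hY, rfl⟩
    exact H X hX Y hY
  have hpc := forall_forall_eq_iff hpmin hpmax
  have hnc := forall_forall_eq_iff hnmin hnmax
  refine ⟨?_, ?_, ?_, ?_, ?_, ?_, ?_, ?_, ?_, ?_, ?_, ?_, ?_, ?_⟩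
  · rw [exists_hermSolutions_iff hunit, exists_eq_max_iff hrmax hrn]
    omega
  · rw [forall_hermSolutions_iff hunit, forall_eq_min_iff hrmin hrn]
    omega
  · rw [exists_hermSolutions_iff hzero, exists_eq_zero_iff hrmin]
    omega
  · rw [forall_hermSolutions_iff hzero, forall_eq_zero_iff hrmax]
    -- The minimum of the two terms may vanish merely because `n₁ = 0`. In that case the least rank
    -- is at most `0` and `B₂.rank` is at most the rank of `[B₁, B₂]`, so the other term vanishes as
    -- well.
    obtain ⟨B', hB, -⟩ := exists_generalized_inverse B₂
    have h1 := rank_fromCols_eq (B₁ := B₁) hB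
    have h2 := hrmin.2 hrmax.1
    have h3 := hpmin.2 hpmax.1
    obtain ⟨W, hW, hWr⟩ := hrmin.1
    dsimp only at hWr
    omega
  · rw [exists_hermSolutions_iff hpd, exists_eq_max_iff hpmax hpn]
    omega
  · rw [exists_hermSolutions_iff hnd, exists_eq_max_iff hnmax hnn]
    omega
  · rw [forall_hermSolutions_iff hpd, forall_eq_min_iff hpmin hpn]
    omega
  · rw [forall_hermSolutions_iff hnd, forall_eq_min_iff hnmin hnn]
    omega
  · rw [exists_hermSolutions_iff hps, exists_eq_zero_iff hnmin]
    omega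
  · rw [exists_hermSolutions_iff hns, exists_eq_zero_iff hpmin]
    omega
  · rw [forall_hermSolutions_iff hps, forall_eq_zero_iff hnmax]
    omega
  · rw [forall_hermSolutions_iff hns, forall_eq_zero_iff hpmax]
    omega
  -- For either sign, maximum minus minimum is `n₁ + r(B₂) - r(B)`, independent of `A`.
  · rw [hconst, hconst, hpc, hnc]
    omega
  · rw [hconst, hnc, ← rank_fromCols_eq_add_iff]
    omega
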